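/- A \emph{linkage} is a graph with a positive length on each edge. A \emph{simple configuration} of it in the plane places the vertices (joints) so that each edge becomes a segment (link) of the prescribed length, links with a common joint meet only in this joint, and all other pairs of links are disjoint. Two simple configurations are \emph{equivalent} if there is a \emph{motion} (a continuous path of simple configurations) from one to the other. \textbf{Corollary.} There are constants $c>0$ and $N_0$ such that for every $N\ge N_0$ there is a tree linkage with $N$ links that has at least $2^{cN}$ equivalence classes of simple configurations. More precisely, for $n>4$ and $0<l_1<1$, $l_2>0$ put $\beta=\arcsin l_1$, $\alpha=(2\pi-\beta)/(n-1)$, $\theta_m=\arccos\frac{1-l_1^2+l_2^2}{2l_2}$, $l_P(\theta)=\cos\theta-\sqrt{l_1^2-\sin^2\theta}$, and call $(n,l_1,l_2)$ \emph{admissible} if $2\pi/n<\beta$, $\sin\beta\cos\beta<l_2<l_P(2\pi/n)$, $l_1+l_2>1$ and $\alpha<\theta_m$. The \emph{petal tree} has a joint $O$ and, for each $i\in\mathbb Z/n$, a petal of three links $OA_i$, $A_iB_i$, $B_iC_i$ of lengths $1,l_1,l_2$. Its \emph{petal angles} are the counterclockwise angles $\theta_i=\angle A_{i-1}OA_i\in[0,2\pi)$.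 Petal $i$ is \emph{restricted} if $\theta_i<\beta$, $B_i$ is on the open small arc $PQ$ of the circle about $A_i$ of radius $l_1$, where $P\in OA_{i-1}$ with $\|OP\|=l_P(\theta_i)$ and $Q\in OA_i$ with $\|OQ\|=1-l_1$ are points of this circle, and $C_i$ is in the open region bounded by the quadrilateral $ORB_iS$, where $R$, $S$ are the feet of the perpendiculars from $B_i$ to $OA_{i-1}$ and $OA_i$. A configuration of the petal tree is \emph{closed} if all petals are restricted with $\theta_i\in(\alpha,\beta)$, and \emph{open} if some $\theta_i<\alpha$. There are $l_1,l_2$ with $(8,l_1,l_2)$ admissible. For all such $l_1,l_2$ there is $L_0$ such that for all $L\ge L_0$, $L>0$, and all $k\ge1$, the linkage formed by $k$ copies of the eight-petal tree whose joints $O$ are joined in a row by $k-1$ links of length $L$ has the following properties. \begin{itemize} \item It is a tree with $24k+(k-1)$ links. \item There are simple configurations, one for each label in $\{\text{closed},\text{open}\}^k$, in which the $k-1$ long links form a straight chain and each copy is closed or open as the label says. They can be chosen with the same cyclic order of links around every joint, and such that any two with different labels are not equivalent. \item In any motion that starts with a given copy closed, this copy remains closed and is never open. \item Hence it has at least $2^k$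 equivalence classes of simple configurations. \end{itemize} -/

import Mathlib

/-! Linkages in the Euclidean plane `ℂ`, their simple configurations and motions, and the petal
trees. -/

noncomputable section

namespace TreeLinkage

/-- A weighted graph: each edge `xy` is a link, of positive length `len x y`. -/
structure Linkage (V : Type*) where
  graph : SimpleGraph V
  len : V → V → ℝ
  len_comm : ∀ x y, len x y = len y x
  len_pos : ∀ x y, graph.Adj x y → 0 < len x y

/-- The number of links. -/
def Linkage.numLinks {V : Type*} (T : Linkage V) : ℕ := T.graph.edgeSet.ncard

/-- `p` places the joints so that all links have their prescribed lengths, links with a common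
joint meet only in this joint, and links without a common joint are disjoint. -/
structure Linkage.IsSimple {V : Type*} (T : Linkage V) (p : V → ℂ) : Prop where
  dist_eq : ∀ x y, T.graph.Adj x y → dist (p x) (p y) = T.len x y
  incident : ∀ x y z, T.graph.Adj x y → T.graph.Adj x z → y ≠ z →
    segment ℝ (p x) (p y) ∩ segment ℝ (p x) (p z) = {p x}
  disjoint : ∀ x y z w, T.graph.Adj x y → T.graph.Adj z w →
    x ≠ z → x ≠ w → y ≠ z → y ≠ w →
    Disjoint (segment ℝ (p x) (p y)) (segment ℝ (p z) (p w))

/-- The space of simple configurations, as a subspace of `V → ℂ`. -/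
abbrev Linkage.Configuration {V : Type*} (T : Linkage V) : Type _ := {p : V → ℂ // T.IsSimple p}

/-- A motion: a continuous movement of the joints through simple configurations. -/
abbrev Linkage.Motion {V : Type*} (T : Linkage V) (p q : T.Configuration) : Type _ := Path p q

/-- Two simple configurations are equivalent if there is a motion from one to the other. -/
def Linkage.Equivalent {V : Type*} (T : Linkage V) (p q : T.Configuration) : Prop :=
  Nonempty (T.Motion p q)

/-- The set of equivalence classes of simple configurations under motion (`ZerothHomotopy` is the
quotient by the relation of being joined by a path). -/
abbrev Linkage.Classes {V : Type*} (T : Linkage V) : Type _ := ZerothHomotopy T.Configuration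

/-- The counterclockwise angle at `O` from the ray `OX` to the ray `OY`, in `[0, 2π)`. -/
def ccwAngle (O X Y : ℂ) : ℝ := toIcoMod Real.two_pi_pos 0 (Complex.arg ((Y - O) / (X - O)))

/-- Two placements have the same cyclic (counterclockwise) order of the links around each joint. -/
def Linkage.SameRotation {V : Type*} (T : Linkage V) (p q : V → ℂ) : Prop :=
  ∀ v a b c, T.graph.Adj v a → T.graph.Adj v b → T.graph.Adj v c →
    (ccwAngle (p v) (p a) (p b) < ccwAngle (p v) (p a) (p c) ↔
      ccwAngle (q v) (q a) (q b) < ccwAngle (q v) (q a) (q c))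

/-! ### The constraints on the link lengths -/

/-- The petal angle at which the circle about `A` of radius `l₁` touches the line `OA'`. -/
def angleBeta (l₁ : ℝ) : ℝ := Real.arcsin l₁

def angleAlpha (n : ℕ) (l₁ : ℝ) : ℝ := (2 * Real.pi - angleBeta l₁) / ((n : ℝ) - 1)

/-- The angle at `O` in a triangle `OAB` with `OA = 1`, `AB = l₁`, `OB = l₂`. -/
def angleMin (l₁ l₂ : ℝ) : ℝ := Real.arccos ((1 - l₁ ^ 2 + l₂ ^ 2) / (2 * l₂))

/-- The distance from `O` to the first intersection of the line `OA'` with the circle about `A` of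
radius `l₁`, when the petal angle is `θ ∈ [0, β]`. -/
def distP (l₁ θ : ℝ) : ℝ := Real.cos θ - Real.sqrt (l₁ ^ 2 - Real.sin θ ^ 2)

/-- The constraints on the number `n` of petals and the link lengths `1, l₁, l₂` of a petal. -/
structure Lockable (n : ℕ) (l₁ l₂ : ℝ) : Prop where
  four_lt : 4 < n
  l₁_pos : 0 < l₁
  l₂_pos : 0 < l₂
  l₁_lt_one : l₁ < 1
  mean_lt_beta : 2 * Real.pi / n < angleBeta l₁
  l₂_lt : l₂ < distP l₁ (2 * Real.pi / n)
  lt_l₂ : Real.sin (angleBeta l₁) * Real.cos (angleBeta l₁) < l₂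
  one_lt_add : 1 < l₁ + l₂
  alpha_lt_min : angleAlpha n l₁ < angleMin l₁ l₂

/-! ### Petal trees and chains of petal trees -/

/-- The joints of a tree of `n` petals: the central joint `O` and `A i, B i, C i` for petal `i`. -/
inductive Joint (n : ℕ) : Type
  | O : Joint n
  | A : Fin n → Joint n
  | B : Fin n → Joint n
  | C : Fin n → Joint n

/-- Petal `i` consists of the links `O A i`, `A i B i`, `B i C i`. -/
def petalAdj {n : ℕ} : Joint n → Joint n → Prop
  | .O, .A _ => True
  | .A _, .O => True
  | .A i, .B j => i = j
  | .B i, .A j => i = j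
  | .B i, .C j => i = j
  | .C i, .B j => i = j
  | _, _ => False

/-- The lengths of the links of a petal; the last value is never used. -/
def petalLen {n : ℕ} (l₁ l₂ : ℝ) : Joint n → Joint n → ℝ
  | .O, .A _ => 1
  | .A _, .O => 1
  | .A _, .B _ => l₁
  | .B _, .A _ => l₁
  | .B _, .C _ => l₂
  | .C _, .B _ => l₂
  | _, _ => 1

theorem petalAdj_symm {n : ℕ} {x y : Joint n} (h : petalAdj x y) : petalAdj y x := by
  cases x <;> cases y <;> simp_all [petalAdj]

theorem petalAdj_irrefl {n : ℕ} (x : Joint n) : ¬ petalAdj x x := by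
  cases x <;> simp [petalAdj]

theorem petalLen_comm {n : ℕ} (l₁ l₂ : ℝ) (x y : Joint n) :
    petalLen l₁ l₂ x y = petalLen l₁ l₂ y x := by
  cases x <;> cases y <;> simp [petalLen]

theorem petalLen_pos {n : ℕ} {l₁ l₂ : ℝ} (h₁ : 0 < l₁) (h₂ : 0 < l₂) (x y : Joint n) :
    0 < petalLen l₁ l₂ x y := by
  cases x <;> cases y <;> simp [petalLen, h₁, h₂]

/-- The tree graph made of `k` copies of the tree of `n` petals; the centres `O` of consecutive
copies are joined by links. -/
def chainGraph (k n : ℕ) : SimpleGraph (Fin k × Joint n) where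
  Adj x y := (x.1 = y.1 ∧ petalAdj x.2 y.2) ∨
    (x.2 = .O ∧ y.2 = .O ∧ (x.1.val + 1 = y.1.val ∨ y.1.val + 1 = x.1.val))
  symm := ⟨fun _ _ h => h.imp (fun h => ⟨h.1.symm, petalAdj_symm h.2⟩)
    (fun h => ⟨h.2.1, h.1, h.2.2.symm⟩)⟩
  loopless := ⟨fun x h => h.elim (fun h => petalAdj_irrefl _ h.2)
    (fun h => by have := h.2.2; omega)⟩

/-- The link lengths in a chain of petal trees: `L` for the links that join the centres. -/
def chainLen {k n : ℕ} (l₁ l₂ L : ℝ) (x y : Fin k × Joint n) : ℝ :=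
  match x.2, y.2 with
  | .O, .O => L
  | a, b => petalLen l₁ l₂ a b

/-- The linkage of `k` copies of a tree of `n` petals with link lengths `1, l₁, l₂`, joined at
their centres in a row by `k - 1` links of length `L`. -/
def chain (k n : ℕ) (l₁ l₂ L : ℝ) (h₁ : 0 < l₁) (h₂ : 0 < l₂) (hL : 0 < L) :
    Linkage (Fin k × Joint n) where
  graph := chainGraph k n
  len := chainLen l₁ l₂ L
  len_comm := by
    rintro ⟨i, x⟩ ⟨j, y⟩
    cases x <;> cases y <;> simp [chainLen, petalLen]
  len_pos := by
    rintro ⟨i, x⟩ ⟨j, y⟩ -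
    cases x <;> cases y <;> simp [chainLen, petalLen, h₁, h₂, hL]

/-! ### Closed and open petal trees -/

/-- The angle of petal `i`, i.e. `∠ A (i - 1) O A i`, with indices mod `n`. -/
def petalAngle {n : ℕ} [NeZero n] (p : Joint n → ℂ) (i : Fin n) : ℝ :=
  ccwAngle (p .O) (p (.A (i - 1))) (p (.A i))

/-- The foot of the perpendicular from `B` to the line `OX`. -/
def foot (O X B : ℂ) : ℂ := O + (inner ℝ (X - O) (B - O) / ‖X - O‖ ^ 2) • (X - O)

/-- The open small arc `PQ` of the circle about `A` through `P` and `Q`: the points of this circle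
in the open convex cone with apex `A` spanned by `P` and `Q`. -/
def openArc (A P Q : ℂ) : Set ℂ :=
  {B | dist B A = dist P A ∧ ∃ s t : ℝ, 0 < s ∧ 0 < t ∧ B - A = s • (P - A) + t • (Q - A)}

/-- Petal `i` is restricted: its angle is less than `β`, `B` is on the open small arc `PQ`, and `C`
is in the open region bounded by the (convex) quadrilateral `ORBS`. Here `P` is the first point of
the ray `OA'` on the circle about `A` of radius `l₁`, `Q` is the point where this circle crosses
`OA`, and `R`, `S` are the feet of the perpendiculars from `B` to `OA'` and `OA`; `OA' = OA = 1`. -/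
def IsRestricted {n : ℕ} [NeZero n] (l₁ : ℝ) (p : Joint n → ℂ) (i : Fin n) : Prop :=
  let O := p .O
  let A' := p (.A (i - 1))
  let A := p (.A i)
  let B := p (.B i)
  let C := p (.C i)
  let P := O + distP l₁ (petalAngle p i) • (A' - O)
  let Q := O + (1 - l₁) • (A - O)
  petalAngle p i < angleBeta l₁ ∧
    B ∈ openArc A P Q ∧
    C ∈ interior (convexHull ℝ {O, foot O A' B, B, foot O A B})

/-- A closed petal tree: every petal is restricted, with its angle in `(α, β)`. -/
def IsClosedTree {n : ℕ} [NeZero n] (l₁ : ℝ) (p : Joint n → ℂ) : Prop :=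
  ∀ i, petalAngle p i ∈ Set.Ioo (angleAlpha n l₁) (angleBeta l₁) ∧ IsRestricted l₁ p i

/-- An open petal tree: some petal angle is less than `α`. -/
def IsOpenTree {n : ℕ} [NeZero n] (l₁ : ℝ) (p : Joint n → ℂ) : Prop :=
  ∃ i, petalAngle p i < angleAlpha n l₁

/-- The placement of the `j`-th petal tree of a chain. -/
def copy {k n : ℕ} (p : Fin k × Joint n → ℂ) (j : Fin k) : Joint n → ℂ := fun x => p (j, x)

/-- The links of length `L` of a chain form a straight chain. -/
def IsStretched {k n : ℕ} (L : ℝ) (p : Fin k × Joint n → ℂ) : Prop :=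
  ∃ a u : ℂ, ‖u‖ = 1 ∧ ∀ j : Fin k, p (j, .O) = a + ((j : ℝ) * L) • u

end TreeLinkage

end

noncomputable section

namespace TreeLinkage

/-! An eight-petal tree that is closed locks itself. With joints taken relative to the centre, a
restricted petal of positive angle is the same as nine strict polynomial inequalities in dot and
cross products (`NestedPetal`, `isRestricted_iff`), so being closed is an open condition along a
motion. It is also a closed condition: the weak versions of these inequalities together with the
bound θ ≥ θₘ (`WeaklyNestedPetal`) define a closed set, and for simple configurations the two sets
coincide. By connectedness of the time interval a closed tree remains closed
(`isClosedTree_of_path`).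

Strict implies weak because l₂ = BC < OB in a nested petal (`NestedPetal.dist_lt`); this makes the
angle AOB, and hence the petal angle, larger than θₘ (`NestedPetal.dot_lt`). Weak implies strict in
two stages. The angles lie in [θₘ, β] and sum to a positive multiple of 2π that is at most 8β < 4π,
so the sum is 2π; one angle equal to β would leave 2π − β = 7α for the other seven, which need at
least 7θₘ > 7α (`IsWeaklyNested.isNested`). With all angles below β, every remaining equality either
makes two links touch or contradicts the lengths: OB² = 1 − l₁² would need an angle of at least β,
and C cannot lie on the perpendicular from B to a side, because B is closer to that side than sin β
cos β < l₂ (`WeaklyNestedPetal.strict_b`, `WeaklyNestedPetal.nested`).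

A closed copy therefore never becomes open, and configurations with different labels are
inequivalent (`not_equivalent_of_labels`). For existence, both kinds of tree are drawn with petal i
inside the i-th of eight disjoint convex sectors that avoid the real axis (`IsFan`, `closedFan`,
`openFan`), and their centres are put on the real axis at distance L ≥ 6 (`fanRow_isSimple`). The
sectors also force the same cyclic orders (`fanRow_sameRotation`). Trees with exactly N links arise
from a row of centres of which only the first ⌊N/25⌋ carry petals. -/

/-! ### Dot and cross products, ccw angles -/

/-- The dot product of two plane vectors. -/
def dot (z w : ℂ) : ℝ := z.re * w.re + z.im * w.im

/-- The cross product (signed area) of two plane vectors. -/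
def cross (z w : ℂ) : ℝ := z.re * w.im - z.im * w.re

theorem dot_comm (z w : ℂ) : dot z w = dot w z := by simp only [dot]; ring

theorem dot_self_eq_one {a : ℂ} (ha : ‖a‖ = 1) : dot a a = 1 := by
  have := Complex.sq_norm a
  rw [ha, Complex.normSq_apply] at this
  simp only [dot]; linarith

theorem dot_self (z : ℂ) : dot z z = ‖z‖ ^ 2 := by
  rw [Complex.sq_norm, Complex.normSq_apply, dot]

/-- For a unit vector u, the pair (`dot u z`, `cross u z`) gives the coordinates of z in the
orthonormal frame (u, iu). Most of the planar geometry below is done in the frame of a link OA' or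
OA. -/
theorem dot_frame {u : ℂ} (hu : dot u u = 1) (z w : ℂ) :
    dot z w = dot u z * dot u w + cross u z * cross u w := by
  have : dot u z * dot u w + cross u z * cross u w = dot u u * dot z w := by
    simp only [dot, cross]; ring
  rw [this, hu, one_mul]

theorem cross_frame {u : ℂ} (hu : dot u u = 1) (z w : ℂ) :
    cross z w = dot u z * cross u w - cross u z * dot u w := by
  have : dot u z * cross u w - cross u z * dot u w = dot u u * cross z w := by
    simp only [dot, cross]; ring
  rw [this, hu, one_mul]

theorem ext_frame {u z w : ℂ} (hu : dot u u = 1) (h₁ : dot u z = dot u w)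
    (h₂ : cross u z = cross u w) : z = w := by
  have key : ∀ v : ℂ, v = ⟨u.re * dot u v - u.im * cross u v, u.re * cross u v + u.im * dot u v⟩ := by
    intro v
    simp only [dot] at hu
    apply Complex.ext
    · simp only [dot, cross]; linear_combination (-v.re) * hu
    · simp only [dot, cross]; linear_combination (-v.im) * hu
  rw [key z, key w, h₁, h₂]

theorem dot_sub (u z w : ℂ) : dot u (z - w) = dot u z - dot u w := by simp [dot]; ring
theorem dot_add (u z w : ℂ) : dot u (z + w) = dot u z + dot u w := by simp [dot]; ring
theorem dot_smul (u : ℂ) (r : ℝ) (z : ℂ) : dot u (r • z) = r * dot u z := by simp [dot]; ring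
theorem cross_sub (u z w : ℂ) : cross u (z - w) = cross u z - cross u w := by simp [cross]; ring
theorem cross_add (u z w : ℂ) : cross u (z + w) = cross u z + cross u w := by simp [cross]; ring
theorem cross_smul (u : ℂ) (r : ℝ) (z : ℂ) : cross u (r • z) = r * cross u z := by
  simp [cross]; ring
theorem cross_self (u : ℂ) : cross u u = 0 := by simp [cross]; ring
theorem cross_swap (u v : ℂ) : cross u v = - cross v u := by simp [cross]; ring

theorem eq_smul_of_cross_eq_zero {u z : ℂ} (hu : dot u u = 1) (h : cross u z = 0) :
    z = dot u z • u := by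
  apply ext_frame hu
  · rw [dot_smul, hu, mul_one]
  · rw [cross_smul, cross_self, h, mul_zero]

theorem ccwAngle_mem (O X Y : ℂ) : ccwAngle O X Y ∈ Set.Ico 0 (2 * Real.pi) := by
  have := toIcoMod_mem_Ico Real.two_pi_pos 0 (Complex.arg ((Y - O) / (X - O)))
  simpa [ccwAngle] using this

theorem ccwAngle_coe (O X Y : ℂ) :
    ∃ m : ℤ, ccwAngle O X Y = Complex.arg ((Y - O) / (X - O)) + m * (2 * Real.pi) := by
  refine ⟨-toIcoDiv Real.two_pi_pos 0 (Complex.arg ((Y - O) / (X - O))), ?_⟩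
  rw [ccwAngle, toIcoMod]
  push_cast
  simp only [zsmul_eq_mul]
  ring

theorem exp_ccwAngle (O X Y : ℂ) :
    (‖(Y - O) / (X - O)‖ : ℂ) * Complex.exp (ccwAngle O X Y * Complex.I) = (Y - O) / (X - O) := by
  obtain ⟨m, hm⟩ := ccwAngle_coe O X Y
  rw [hm]
  push_cast
  rw [add_mul, Complex.exp_add, mul_assoc (m : ℂ), Complex.exp_int_mul_two_pi_mul_I, mul_one,
    Complex.norm_mul_exp_arg_mul_I]

theorem ccwAngle_eq {O X Y : ℂ} {θ r : ℝ} (hθ : θ ∈ Set.Ico 0 (2 * Real.pi)) (hr : 0 < r)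
    (hX : X ≠ O) (h : Y - O = r * Complex.exp (θ * Complex.I) * (X - O)) :
    ccwAngle O X Y = θ := by
  have hq : (Y - O) / (X - O) = r * Complex.exp (θ * Complex.I) := by
    rw [h, mul_div_assoc, div_self (sub_ne_zero.2 hX), mul_one]
  rw [ccwAngle, hq, Complex.arg_real_mul _ hr, Complex.arg_exp_mul_I,
    toIcoMod_toIocMod, (toIcoMod_eq_self _).2]
  simpa using hθ

/-- The counterclockwise angle jumps where the rays coincide, but its cosine and sine are
polynomials in the joints. Stating petal conditions through them makes the open and closed sets
visible. -/
theorem cos_ccwAngle {O X Y : ℂ} (hX : ‖X - O‖ = 1) (hY : ‖Y - O‖ = 1) :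
    Real.cos (ccwAngle O X Y) = dot (X - O) (Y - O) ∧
      Real.sin (ccwAngle O X Y) = cross (X - O) (Y - O) := by
  have h := exp_ccwAngle O X Y
  have h0 : X - O ≠ 0 := by rw [← norm_ne_zero_iff, hX]; norm_num
  rw [norm_div, hX, hY, div_one, Complex.ofReal_one, one_mul, eq_div_iff h0,
    Complex.exp_ofReal_mul_I] at h
  have hu := dot_self_eq_one hX
  have h1 := congrArg Complex.re h
  have h2 := congrArg Complex.im h
  simp [-Complex.ofReal_cos, -Complex.ofReal_sin] at h1 h2
  simp only [dot, cross, Complex.sub_re, Complex.sub_im] at hu ⊢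
  rw [← h1, ← h2]
  constructor
  · linear_combination (-Real.cos (ccwAngle O X Y)) * hu
  · linear_combination (-Real.sin (ccwAngle O X Y)) * hu

/-! ### Restricted petals in terms of dot and cross products -/

theorem cos_angleBeta (l₁ : ℝ) : Real.cos (angleBeta l₁) = Real.sqrt (1 - l₁ ^ 2) :=
  Real.cos_arcsin l₁

theorem cos_angleBeta_pos {l₁ : ℝ} (h₀ : 0 < l₁) (h₁ : l₁ < 1) :
    0 < Real.cos (angleBeta l₁) := by
  rw [cos_angleBeta]; apply Real.sqrt_pos.2; nlinarith

theorem cos_angleBeta_sq {l₁ : ℝ} (h₀ : 0 < l₁) (h₁ : l₁ < 1) :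
    Real.cos (angleBeta l₁) ^ 2 = 1 - l₁ ^ 2 := by
  rw [cos_angleBeta, Real.sq_sqrt]; nlinarith

theorem sin_angleBeta {l₁ : ℝ} (h₀ : 0 < l₁) (h₁ : l₁ < 1) : Real.sin (angleBeta l₁) = l₁ :=
  Real.sin_arcsin (by linarith) (by linarith)

theorem angleBeta_pos {l₁ : ℝ} (h₀ : 0 < l₁) : 0 < angleBeta l₁ := Real.arcsin_pos.2 h₀

theorem angleBeta_lt {l₁ : ℝ} (h₁ : l₁ < 1) : angleBeta l₁ < Real.pi / 2 :=
  Real.arcsin_lt_pi_div_two.2 h₁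

/-- The strict inequalities satisfied by a restricted petal, with joints relative to the centre. -/
structure NestedPetal (l₁ : ℝ) (a' a b c : ℂ) : Prop where
  cross_pos : 0 < cross a' a
  lt_dot : Real.cos (angleBeta l₁) < dot a' a
  left_b : 0 < cross a' b
  right_b : 0 < cross b a
  norm_b : dot b b < 1 - l₁ ^ 2
  left_c : 0 < cross a' c
  right_c : 0 < cross c a
  dot_left : dot a' c < dot a' b
  dot_right : dot a c < dot a b

/-- The closure of the inequalities of a nested petal, with a bound on the petal angle. -/
structure WeaklyNestedPetal (l₁ l₂ : ℝ) (a' a b c : ℂ) : Prop where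
  cross_nonneg : 0 ≤ cross a' a
  le_dot : Real.cos (angleBeta l₁) ≤ dot a' a
  dot_le : dot a' a ≤ Real.cos (angleMin l₁ l₂)
  left_b : 0 ≤ cross a' b
  right_b : 0 ≤ cross b a
  norm_b : dot b b ≤ 1 - l₁ ^ 2
  left_c : 0 ≤ cross a' c
  right_c : 0 ≤ cross c a
  dot_left : dot a' c ≤ dot a' b
  dot_right : dot a c ≤ dot a b

/-- On [0, 2π) a positive sine forces θ into (0, π), where the cosine is strictly decreasing. -/
theorem mem_Ioo_iff {θ β c h : ℝ} (hβ : β < Real.pi / 2) (hβ0 : 0 < β)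
    (hθ : θ ∈ Set.Ico 0 (2 * Real.pi)) (hc : Real.cos θ = c) (hs : Real.sin θ = h) :
    θ ∈ Set.Ioo 0 β ↔ 0 < h ∧ Real.cos β < c := by
  subst hc hs
  have hpi := Real.pi_pos
  constructor
  · rintro ⟨h1, h2⟩
    exact ⟨Real.sin_pos_of_pos_of_lt_pi h1 (by linarith),
      Real.cos_lt_cos_of_nonneg_of_le_pi h1.le (by linarith) h2⟩
  · rintro ⟨h1, h2⟩
    have hlt : θ < Real.pi := by
      by_contra hge
      push Not at hge
      have h3 : 0 ≤ Real.sin (θ - Real.pi) :=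
        Real.sin_nonneg_of_nonneg_of_le_pi (by linarith) (by linarith [hθ.2])
      rw [Real.sin_sub_pi] at h3
      linarith
    refine ⟨lt_of_le_of_ne hθ.1 ?_, ?_⟩
    · rintro rfl
      simp at h1
    · by_contra hge
      push Not at hge
      have := Real.cos_le_cos_of_nonneg_of_le_pi hβ0.le hlt.le hge
      linarith

/-- The circle about `A` of radius `l₁` in the frame of `OA'`: membership in the small arc. -/
theorem arc_coordinates {l₁ c₀ h w X Y : ℝ} (hl : 0 < l₁) (hl1 : l₁ < 1) (hc : 0 < c₀) (hh : 0 < h)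
    (hu : c₀ ^ 2 + h ^ 2 = 1) (hw : 0 ≤ w) (hw2 : w ^ 2 = l₁ ^ 2 - h ^ 2)
    (hXY : X ^ 2 + Y ^ 2 = l₁ ^ 2) :
    (∃ s t : ℝ, 0 < s ∧ 0 < t ∧ X = s * w + t * (l₁ * c₀) ∧ Y = s * h + t * (l₁ * h)) ↔
      Y < h ∧ 0 < Y * c₀ - X * h ∧ l₁ ^ 2 < X * c₀ + Y * h := by
  have hwc : w < c₀ := by nlinarith
  constructor
  · rintro ⟨s, t, hs, ht, hX, hY⟩
    have hm : 0 < w * c₀ + h ^ 2 := by positivity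
    -- Here (w, h) = A − P and l₁(c₀, h) = A − Q, and (X, Y) stands for A − B. This is
    -- Cauchy–Schwarz for (w, h) and the unit vector (c₀, h).
    have hm1 : w * c₀ + h ^ 2 ≤ l₁ := by
      have : (w * c₀ + h ^ 2) ^ 2 ≤ l₁ ^ 2 := by
        have e : (w ^ 2 + h ^ 2) * (c₀ ^ 2 + h ^ 2) = l₁ ^ 2 := by rw [hu, hw2]; ring
        nlinarith [sq_nonneg (w * h - h * c₀)]
      exact (abs_le_of_sq_le_sq' this hl.le).2
    -- P, Q and B have the same distance to A, so by the triangle inequality B lies on or beyond the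
    -- chord PQ.
    have hst : 1 ≤ s + t := by
      have e : l₁ ^ 2 = s ^ 2 * l₁ ^ 2 + t ^ 2 * l₁ ^ 2 + 2 * s * t * l₁ * (w * c₀ + h ^ 2) := by
        have hE := hXY
        rw [hX, hY] at hE
        linear_combination -hE + s ^ 2 * hw2 + t ^ 2 * l₁ ^ 2 * hu
      have h2 : l₁ ^ 2 ≤ (s + t) ^ 2 * l₁ ^ 2 := by
        have : 2 * s * t * l₁ * (w * c₀ + h ^ 2) ≤ 2 * s * t * l₁ * l₁ := by gcongr
        nlinarith
      have h3 : 1 ≤ (s + t) ^ 2 := by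
        by_contra hlt
        push Not at hlt
        have : 0 < l₁ ^ 2 := by positivity
        nlinarith
      nlinarith
    refine ⟨?_, ?_, ?_⟩
    · by_contra hge
      push Not at hge
      have h1 : 1 ≤ s + t * l₁ := by
        by_contra hlt
        push Not at hlt
        nlinarith
      have h2 : w < X := by
        have : w ≤ (s + t * l₁) * w := by nlinarith
        have : t * l₁ * w < t * l₁ * c₀ := by gcongr
        nlinarith
      nlinarith
    · rw [hX, hY]
      have : 0 < s * h * (c₀ - w) := by
        have : 0 < c₀ - w := by linarith
        positivity
      nlinarith
    · have e : X * c₀ + Y * h = s * (w * c₀ + h ^ 2) + t * l₁ := by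
        rw [hX, hY]; linear_combination t * l₁ * hu
      have h1 : l₁ ^ 2 ≤ w * c₀ + h ^ 2 := by nlinarith
      have h2 : t * l₁ ^ 2 < t * l₁ := by
        have : l₁ ^ 2 < l₁ := by nlinarith
        gcongr
      have h3 : s * l₁ ^ 2 ≤ s * (w * c₀ + h ^ 2) := by gcongr
      nlinarith
  · rintro ⟨hY, hr, hn⟩
    have hX : 0 < X := by
      by_contra hle
      push Not at hle
      have : h ^ 2 ≤ l₁ ^ 2 := by nlinarith
      have : X * c₀ ≤ 0 := mul_nonpos_of_nonpos_of_nonneg hle hc.le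
      nlinarith
    have hcr : 0 < X * h - w * Y := by
      rcases le_or_gt Y 0 with h0 | h0
      · nlinarith [mul_pos hX hh]
      · have : w < X := by nlinarith
        nlinarith
    have hd : 0 < c₀ - w := by linarith
    -- Cramer's rule in the basis A − P, A − Q.
    refine ⟨(Y * c₀ - X * h) / (h * (c₀ - w)), (X * h - w * Y) / (l₁ * h * (c₀ - w)),
      by positivity, by positivity, ?_, ?_⟩
    · field_simp; ring
    · field_simp; ring

theorem frame_sq {a' a : ℂ} (ha' : dot a' a' = 1) (ha : dot a a = 1) :
    dot a' a ^ 2 + cross a' a ^ 2 = 1 := by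
  have := dot_frame ha' a a
  rw [ha] at this; nlinarith

/-- The open small arc `PQ` of the circle about `A` of radius `l₁`, for a petal angle in `(0, β)`. -/
theorem mem_openArc_iff {l₁ θ : ℝ} {o a' a b : ℂ} (hl : 0 < l₁) (hl1 : l₁ < 1)
    (ha' : dot a' a' = 1) (ha : dot a a = 1) (hc : Real.cos θ = dot a' a)
    (hs : Real.sin θ = cross a' a) (hh : 0 < cross a' a)
    (hβ : Real.cos (angleBeta l₁) < dot a' a) (hb : dist (o + b) (o + a) = l₁) :
    o + b ∈ openArc (o + a) (o + distP l₁ θ • a') (o + (1 - l₁) • a) ↔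
      0 < cross a' b ∧ 0 < cross b a ∧ dot b b < 1 - l₁ ^ 2 := by
  have hcb := cos_angleBeta_pos hl hl1
  have hcb2 := cos_angleBeta_sq hl hl1
  have hu := frame_sq ha' ha
  have hw2 : Real.sqrt (l₁ ^ 2 - cross a' a ^ 2) ^ 2 = l₁ ^ 2 - cross a' a ^ 2 := by
    apply Real.sq_sqrt; nlinarith
  have hw := Real.sqrt_nonneg (l₁ ^ 2 - cross a' a ^ 2)
  have hP : distP l₁ θ = dot a' a - Real.sqrt (l₁ ^ 2 - cross a' a ^ 2) := by
    rw [distP, hc, hs]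
  rw [hP]
  set w := Real.sqrt (l₁ ^ 2 - cross a' a ^ 2)
  have hXY : (dot a' a - dot a' b) ^ 2 + (cross a' a - cross a' b) ^ 2 = l₁ ^ 2 := by
    rw [dist_add_left, dist_eq_norm] at hb
    rw [← hb, ← dot_self, dot_frame ha' (b - a), dot_sub, cross_sub]; ring
  have key := arc_coordinates hl hl1 (hcb.trans hβ) hh hu hw hw2 hXY
  have hdist : dist (o + (dot a' a - w) • a') (o + a) = l₁ := by
    rw [dist_add_left, dist_eq_norm]
    have : ‖(dot a' a - w) • a' - a‖ ^ 2 = l₁ ^ 2 := by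
      rw [← dot_self, dot_frame ha', dot_sub, cross_sub, dot_smul, cross_smul, ha', cross_self]
      linear_combination hw2
    exact (sq_eq_sq₀ (norm_nonneg _) hl.le).1 this
  have hmem : o + b ∈ openArc (o + a) (o + (dot a' a - w) • a') (o + (1 - l₁) • a) ↔
      ∃ s t : ℝ, 0 < s ∧ 0 < t ∧ dot a' a - dot a' b = s * w + t * (l₁ * dot a' a) ∧
        cross a' a - cross a' b = s * cross a' a + t * (l₁ * cross a' a) := by
    simp only [openArc, Set.mem_ofPred_eq, hb, hdist, true_and]
    refine exists_congr fun s => exists_congr fun t => and_congr_right fun _ =>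
      and_congr_right fun _ => ?_
    have e1 : o + b - (o + a) = b - a := by ring
    have e2 : o + (dot a' a - w) • a' - (o + a) = (dot a' a - w) • a' - a := by ring
    have e3 : o + (1 - l₁) • a - (o + a) = (1 - l₁) • a - a := by ring
    rw [e1, e2, e3]
    constructor
    · intro h
      have h1 := congrArg (dot a') h
      have h2 := congrArg (cross a') h
      simp only [dot_sub, dot_add, dot_smul, cross_sub, cross_add, cross_smul, ha', cross_self]
        at h1 h2
      constructor
      · linear_combination -h1
      · linear_combination -h2
    · rintro ⟨h1, h2⟩
      apply ext_frame ha'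
      · simp only [dot_sub, dot_add, dot_smul, ha']
        linear_combination -h1
      · simp only [cross_sub, cross_add, cross_smul, cross_self]
        linear_combination -h2
  rw [hmem, key, cross_frame ha' b a, dot_frame ha' b b]
  have eb : dot a' b ^ 2 + cross a' b ^ 2 =
      l₁ ^ 2 - 1 + 2 * (dot a' a * dot a' b + cross a' a * cross a' b) := by
    linear_combination hXY - hu
  refine and_congr (by constructor <;> intro h <;> linarith) (and_congr ?_ ?_)
  · have : (cross a' a - cross a' b) * dot a' a - (dot a' a - dot a' b) * cross a' a =
      dot a' b * cross a' a - cross a' b * dot a' a := by ring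
    rw [this]
  · constructor <;> intro h <;> nlinarith

/-- Pushing an interior point slightly outwards across a bounding line turns the weak inequality for
the hull into a strict one for the point. -/
theorem exists_add_smul_mem {s : Set ℂ} {z : ℂ} (hz : z ∈ interior s) (v : ℂ) :
    ∃ ε : ℝ, 0 < ε ∧ z + ε • v ∈ s := by
  have hc : Continuous fun ε : ℝ => z + ε • v := by fun_prop
  have ht : Filter.Tendsto (fun ε : ℝ => z + ε • v) (nhdsWithin 0 (Set.Ioi 0)) (nhds z) := by
    have := hc.tendsto 0
    simp only [zero_smul, add_zero] at this
    exact this.mono_left nhdsWithin_le_nhds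
  obtain ⟨ε, h1, h2⟩ :=
    ((ht.eventually_mem (mem_interior_iff_mem_nhds.1 hz)).and self_mem_nhdsWithin).exists
  exact ⟨ε, h2, h1⟩

theorem combo_mem_convexHull {s : Set ℂ} {x y z : ℂ} (hx : x ∈ s) (hy : y ∈ s) (hz : z ∈ s)
    {p q r : ℝ} (hp : 0 ≤ p) (hq : 0 ≤ q) (hr : 0 ≤ r) (h : p + q + r = 1) :
    p • x + q • y + r • z ∈ convexHull ℝ s := by
  have := (convex_convexHull ℝ s).sum_mem (t := Finset.univ) (w := ![p, q, r]) (z := ![x, y, z])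
    (by intro i _; fin_cases i <;> simp [hp, hq, hr])
    (by simp [Fin.sum_univ_three, h])
    (by intro i _; fin_cases i <;> exact subset_convexHull ℝ s (by assumption))
  simpa [Fin.sum_univ_three] using this

theorem isOpen_quadrilateral (o a' a b : ℂ) : IsOpen {z : ℂ | 0 < cross a' (z - o) ∧
    0 < cross (z - o) a ∧ dot a' (z - o) < dot a' b ∧ dot a (z - o) < dot a b} := by
  simp only [dot, cross]
  refine IsOpen.and ?_ (IsOpen.and ?_ (IsOpen.and ?_ ?_)) <;>
    exact isOpen_lt (by fun_prop) (by fun_prop)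

/-- The open region bounded by the quadrilateral `ORBS`. -/
theorem mem_interior_quadrilateral_iff {o a' a b c : ℂ} (ha' : dot a' a' = 1) (ha : dot a a = 1)
    (hc : 0 < dot a' a) (hh : 0 < cross a' a) (hb' : 0 < cross a' b) (hb : 0 < cross b a) :
    o + c ∈ interior (convexHull ℝ {o, o + dot a' b • a', o + b, o + dot a b • a}) ↔
      0 < cross a' c ∧ 0 < cross c a ∧ dot a' c < dot a' b ∧ dot a c < dot a b := by
  have hu := frame_sq ha' ha
  have hx : 0 < dot a' b := by
    have := cross_frame ha' b a
    by_contra hle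
    push Not at hle
    have : dot a' b * cross a' a ≤ 0 := mul_nonpos_of_nonpos_of_nonneg hle hh.le
    have : 0 < cross a' b * dot a' a := by positivity
    linarith
  have hfab : dot a b = dot a' b * dot a' a + cross a' b * cross a' a := by
    rw [dot_comm, dot_frame ha' b a]
  have hxb : 0 < dot a b := by rw [hfab]; positivity
  have hcr := cross_frame ha' b a
  constructor
  · intro hz
    have hsub : convexHull ℝ {o, o + dot a' b • a', o + b, o + dot a b • a} ⊆
        {z : ℂ | 0 ≤ cross a' (z - o) ∧ 0 ≤ cross (z - o) a ∧ dot a' (z - o) ≤ dot a' b ∧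
          dot a (z - o) ≤ dot a b} := by
      apply convexHull_min
      · have haa : cross (dot a' b • a') a = dot a' b * cross a' a := by
          rw [cross_swap, cross_smul, cross_swap a]; ring
        have hbb : cross (dot a b • a) a = 0 := by rw [cross_swap, cross_smul, cross_self]; ring
        rintro z (rfl | rfl | rfl | rfl)
        · simp only [Set.mem_ofPred_eq, sub_self]
          simp [dot, cross]
          exact ⟨by simpa [dot] using hx.le, by simpa [dot] using hxb.le⟩
        · simp only [Set.mem_ofPred_eq, add_sub_cancel_left, cross_smul, cross_self, haa, dot_smul,
            ha', dot_comm a a', hfab]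
          refine ⟨by simp, by positivity, by simp, ?_⟩
          have : 0 < cross a' b * cross a' a := by positivity
          linarith
        · simp only [Set.mem_ofPred_eq, add_sub_cancel_left]
          exact ⟨hb'.le, hb.le, le_rfl, le_rfl⟩
        · simp only [Set.mem_ofPred_eq, add_sub_cancel_left, cross_smul, hbb, dot_smul, ha]
          refine ⟨by positivity, le_rfl, ?_, by simp⟩
          have : 0 < cross a' a * (dot a' b * cross a' a - cross a' b * dot a' a) := by
            rw [← hcr]; positivity
          rw [hfab]
          nlinarith
      · intro x hx y hy p q hp hq hpq
        obtain ⟨x1, x2, x3, x4⟩ := hx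
        obtain ⟨y1, y2, y3, y4⟩ := hy
        have e : p • x + q • y - o = p • (x - o) + q • (y - o) := by
          have : o = (p + q) • o := by rw [hpq, one_smul]
          conv_lhs => rw [this]
          simp only [smul_sub, add_smul]; ring
        simp only [Set.mem_ofPred_eq]
        rw [cross_swap] at x2 y2
        rw [e, cross_swap _ a]
        simp only [cross_add, cross_smul, dot_add, dot_smul]
        refine ⟨by positivity, ?_, ?_, ?_⟩
        · have := mul_nonneg hp x2; have := mul_nonneg hq y2; linarith
        · have h1 := mul_le_mul_of_nonneg_left x3 hp
          have h2 := mul_le_mul_of_nonneg_left y3 hq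
          have : dot a' b = p * dot a' b + q * dot a' b := by rw [← add_mul, hpq, one_mul]
          linarith
        · have h1 := mul_le_mul_of_nonneg_left x4 hp
          have h2 := mul_le_mul_of_nonneg_left y4 hq
          have : dot a b = p * dot a b + q * dot a b := by rw [← add_mul, hpq, one_mul]
          linarith
    -- The four pushes, by −a, −a', a' and a, each tighten one of the four inequalities.
    have hadd : ∀ (ε : ℝ) (v : ℂ), o + c + ε • v - o = c + ε • v := by intros; ring
    refine ⟨?_, ?_, ?_, ?_⟩
    · obtain ⟨ε, hε, hm⟩ := exists_add_smul_mem hz (-a)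
      have := (hsub hm).1
      rw [hadd, cross_add, cross_smul] at this
      have e : cross a' (-a) = - cross a' a := by simp [cross]; ring
      rw [e] at this
      nlinarith
    · obtain ⟨ε, hε, hm⟩ := exists_add_smul_mem hz (-a')
      have := (hsub hm).2.1
      rw [hadd, cross_swap, cross_add, cross_smul] at this
      have e : cross a (-a') = cross a' a := by simp [cross]; ring
      rw [e] at this
      rw [cross_swap]
      nlinarith
    · obtain ⟨ε, hε, hm⟩ := exists_add_smul_mem hz a'
      have := (hsub hm).2.2.1
      rw [hadd, dot_add, dot_smul, ha'] at this
      linarith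
    · obtain ⟨ε, hε, hm⟩ := exists_add_smul_mem hz a
      have := (hsub hm).2.2.2
      rw [hadd, dot_add, dot_smul, ha] at this
      linarith
  · intro hz
    have hsub : {z : ℂ | 0 < cross a' (z - o) ∧ 0 < cross (z - o) a ∧
        dot a' (z - o) < dot a' b ∧ dot a (z - o) < dot a b} ⊆
        convexHull ℝ {o, o + dot a' b • a', o + b, o + dot a b • a} := by
      rintro z ⟨z1, z2, z3, z4⟩
      obtain ⟨v, rfl⟩ : ∃ v, z = o + v := ⟨z - o, by ring⟩
      rw [add_sub_cancel_left] at z1 z2 z3 z4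
      -- The diagonal OB cuts the quadrilateral into the triangles ORB and OBS. In each of them v is
      -- written with explicit barycentric coordinates.
      rcases le_total (cross b v) 0 with hv | hv
      · have e : v = ((dot a' v - cross a' v / cross a' b * dot a' b) / dot a' b) • (dot a' b • a') +
            (cross a' v / cross a' b) • b := by
          apply ext_frame ha'
          · simp only [dot_add, dot_smul, ha']; field_simp; ring
          · simp only [cross_add, cross_smul, cross_self]; field_simp; ring
        have h1 : 0 ≤ cross a' v / cross a' b := by positivity
        have h2 : 0 ≤ (dot a' v - cross a' v / cross a' b * dot a' b) / dot a' b := by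
          apply div_nonneg _ hx.le
          rw [cross_frame ha'] at hv
          rw [sub_nonneg, div_mul_eq_mul_div, div_le_iff₀ hb']
          linarith
        have h3 : (dot a' v - cross a' v / cross a' b * dot a' b) / dot a' b +
            cross a' v / cross a' b ≤ 1 := by
          have : (dot a' v - cross a' v / cross a' b * dot a' b) / dot a' b +
            cross a' v / cross a' b = dot a' v / dot a' b := by field_simp; ring
          rw [this, div_le_one hx]; exact z3.le
        set r := (dot a' v - cross a' v / cross a' b * dot a' b) / dot a' b
        set q := cross a' v / cross a' b
        have := combo_mem_convexHull (s := {o, o + dot a' b • a', o + b, o + dot a b • a})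
          (x := o) (y := o + dot a' b • a') (z := o + b) (by simp) (by simp) (by simp)
          (p := 1 - r - q) (q := r) (r := q) (by linarith) h2 h1 (by ring)
        convert this using 1
        conv_lhs => rw [e]
        simp only [smul_add, sub_smul, one_smul]; ring
      · have hba : 0 < cross b a := hb
        have e : v = ((dot a v - cross v a / cross b a * dot a b) / dot a b) • (dot a b • a) +
            (cross v a / cross b a) • b := by
          apply ext_frame ha
          · simp only [dot_add, dot_smul, ha]; field_simp; ring
          · simp only [cross_add, cross_smul, cross_self]
            rw [cross_swap v a, cross_swap b a]
            have : cross a b ≠ 0 := by rw [cross_swap]; linarith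
            field_simp; ring
        have h1 : 0 ≤ cross v a / cross b a := by positivity
        have h2 : 0 ≤ (dot a v - cross v a / cross b a * dot a b) / dot a b := by
          apply div_nonneg _ hxb.le
          rw [cross_frame ha, cross_swap a b, cross_swap a v] at hv
          rw [sub_nonneg, div_mul_eq_mul_div, div_le_iff₀ hb]
          linarith
        have h3 : (dot a v - cross v a / cross b a * dot a b) / dot a b +
            cross v a / cross b a ≤ 1 := by
          have : (dot a v - cross v a / cross b a * dot a b) / dot a b +
            cross v a / cross b a = dot a v / dot a b := by field_simp; ring
          rw [this, div_le_one hxb]; exact z4.le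
        set r := (dot a v - cross v a / cross b a * dot a b) / dot a b
        set q := cross v a / cross b a
        have := combo_mem_convexHull (s := {o, o + dot a' b • a', o + b, o + dot a b • a})
          (x := o) (y := o + dot a b • a) (z := o + b) (by simp) (by simp) (by simp)
          (p := 1 - r - q) (q := r) (r := q) (by linarith) h2 h1 (by ring)
        convert this using 1
        conv_lhs => rw [e]
        simp only [smul_add, sub_smul, one_smul]; ring
    refine interior_maximal hsub (isOpen_quadrilateral o a' a b) ?_
    simpa only [Set.mem_ofPred_eq, add_sub_cancel_left] using hz

/-! ### Metric inequalities of a single petal and of its boundary cases -/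

theorem dot_self_sub (z w : ℂ) : dot (z - w) (z - w) = dot z z - 2 * dot z w + dot w w := by
  simp [dot]; ring

theorem dot_self_nonneg (z : ℂ) : 0 ≤ dot z z := by rw [dot_self]; positivity

theorem smul_mem_segment {t : ℝ} (h0 : 0 ≤ t) (h1 : t ≤ 1) (z : ℂ) : t • z ∈ segment ℝ 0 z :=
  ⟨1 - t, t, by linarith, h0, by ring, by simp⟩

/-- The argument of the arccosine is at most 1 exactly when (1 − l₂)² ≤ l₁², which is the triangle
inequality 1 ≤ l₁ + l₂. -/
theorem cos_angleMin {l₁ l₂ : ℝ} (h₁ : l₁ < 1) (h₁' : 0 < l₁) (h₂' : l₂ < 1)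
    (h : 1 < l₁ + l₂) :
    Real.cos (angleMin l₁ l₂) = (1 - l₁ ^ 2 + l₂ ^ 2) / (2 * l₂) := by
  apply Real.cos_arccos
  · have : 0 ≤ (1 - l₁ ^ 2 + l₂ ^ 2) / (2 * l₂) := div_nonneg (by nlinarith) (by linarith)
    linarith
  · rw [div_le_one (by linarith)]; nlinarith

/-- In a restricted petal, `C` is closer to `B` than the centre is. -/
theorem NestedPetal.dist_lt {l₁ : ℝ} {a' a b c : ℂ} (h : NestedPetal l₁ a' a b c)
    (hβ : 0 ≤ Real.cos (angleBeta l₁)) :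
    dot (c - b) (c - b) < dot b b := by
  have hc := hβ.trans_lt h.lt_dot
  have hh := h.cross_pos
  have hp := h.right_c
  have hq := h.left_c
  have hx := h.dot_left
  have hz := h.dot_right
  -- Cramer's rule: c is a positive combination of a' and a. Since b − c has positive product with
  -- both, it has positive product with c.
  have e : ∀ v, cross a' a * dot v c = cross c a * dot a' v + cross a' c * dot a v := by
    intro v; simp only [cross, dot]; ring
  have e1 := e (b - c)
  have e2 := e b
  rw [dot_sub, dot_sub] at e1
  have k1 : 0 < dot (b - c) c := by
    have : 0 < cross a' a * dot (b - c) c := by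
      rw [e1]
      have := mul_pos hp (sub_pos.2 hx)
      have := mul_pos hq (sub_pos.2 hz)
      linarith
    exact pos_of_mul_pos_right this hh.le
  have k2 : 0 ≤ dot c c := dot_self_nonneg c
  have k3 : dot (b - c) c = dot b c - dot c c := by simp [dot]; ring
  rw [dot_self_sub, dot_comm c b]
  linarith

/-- The angle of a restricted petal exceeds `θₘ`. -/
theorem NestedPetal.dot_lt {l₁ l₂ : ℝ} {a' a b c : ℂ} (h : NestedPetal l₁ a' a b c)
    (h₁ : l₁ < 1) (h₁' : 0 < l₁) (h₂ : 0 < l₂) (h₂' : l₂ < 1) (h₁₂ : 1 < l₁ + l₂)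
    (ha' : dot a' a' = 1) (ha : dot a a = 1) (hb : dot (b - a) (b - a) = l₁ ^ 2)
    (hc : dot (c - b) (c - b) = l₂ ^ 2) :
    dot a' a < Real.cos (angleMin l₁ l₂) := by
  have hβ := cos_angleBeta_pos h₁' h₁
  have hu := frame_sq ha' ha
  have hd := h.dist_lt hβ.le
  have hN := h.norm_b
  rw [hc] at hd
  have hc0 := hβ.trans h.lt_dot
  have hy := h.left_b
  have hr := h.right_b
  have hD : dot b a = (dot b b + 1 - l₁ ^ 2) / 2 := by
    rw [dot_self_sub, ha] at hb; linarith
  have hDR : dot b a ^ 2 + cross b a ^ 2 = dot b b := by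
    have h1 := dot_frame ha b b
    rw [dot_comm b a, cross_swap b a]; linarith
  have hNN : dot a' b ^ 2 + cross a' b ^ 2 = dot b b := by
    have h1 := dot_frame ha' b b
    linarith
  rw [cos_angleMin h₁ h₁' h₂' h₁₂]
  -- The angle AOB is smaller than the petal angle θ, so its sine is smaller than sin θ.
  have hRh : cross b a ^ 2 < cross a' a ^ 2 * dot b b := by
    have e := cross_frame ha' b a
    have h1 : cross b a < dot a' b * cross a' a := by
      have : 0 < cross a' b * dot a' a := by positivity
      linarith
    have h2 : cross b a ^ 2 < (dot a' b * cross a' a) ^ 2 := by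
      apply pow_lt_pow_left₀ h1 hr.le; norm_num
    have h3 : 0 ≤ cross a' b ^ 2 * cross a' a ^ 2 := by positivity
    rw [← hNN]; nlinarith
  set N := Real.sqrt (dot b b) with hNdef
  have hNs : N ^ 2 = dot b b := Real.sq_sqrt (dot_self_nonneg b)
  have hNpos : l₂ < N := Real.lt_sqrt_of_sq_lt hd
  rw [← hNs] at hD hDR hRh hN
  have hD0 : 0 < dot b a := by rw [hD]; nlinarith
  have hlt : dot a' a * N < dot b a := by
    have : (dot a' a * N) ^ 2 < dot b a ^ 2 := by
      have : cross a' a ^ 2 = 1 - dot a' a ^ 2 := by linarith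
      rw [this] at hRh; nlinarith
    exact lt_of_pow_lt_pow_left₀ 2 hD0.le this
  have hNp : 0 < N := h₂.trans hNpos
  have h5 : dot a' a < dot b a / N := by rwa [lt_div_iff₀ hNp]
  refine h5.trans ?_
  rw [hD, div_div, div_lt_div_iff₀ (by positivity) (by positivity)]
  -- The cosine of AOB is (1 − l₁² + N²)/(2N) with N = OB. This decreases while N² < 1 − l₁², and l₂
  -- < N, so it is less than its value cos θₘ at l₂.
  have h6 : 0 < (N - l₂) * (1 - l₁ ^ 2 - l₂ * N) := by
    apply mul_pos (by linarith)
    nlinarith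
  nlinarith

theorem NestedPetal.weakly {l₁ l₂ : ℝ} {a' a b c : ℂ} (h : NestedPetal l₁ a' a b c)
    (hm : dot a' a < Real.cos (angleMin l₁ l₂)) : WeaklyNestedPetal l₁ l₂ a' a b c where
  cross_nonneg := h.cross_pos.le
  le_dot := h.lt_dot.le
  dot_le := hm.le
  left_b := h.left_b.le
  right_b := h.right_b.le
  norm_b := h.norm_b.le
  left_c := h.left_c.le
  right_c := h.right_c.le
  dot_left := h.dot_left.le
  dot_right := h.dot_right.le

/-- The distances of a point of the cone to its sides. -/
theorem cone_sq_le {a' a b : ℂ} (ha' : dot a' a' = 1) (ha : dot a a = 1)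
    (hh : 0 < cross a' a) (hc0 : 0 < dot a' a) (hy : 0 ≤ cross a' b) (hr : 0 ≤ cross b a) :
    0 ≤ dot a' b ∧ cross a' b ^ 2 ≤ cross a' a ^ 2 * dot b b ∧
      cross b a ^ 2 ≤ cross a' a ^ 2 * dot b b := by
  have hu := frame_sq ha' ha
  have hNN : dot a' b ^ 2 + cross a' b ^ 2 = dot b b := by
    have h1 := dot_frame ha' b b
    linarith
  have eR := cross_frame ha' b a
  have hp : 0 ≤ cross a' b * dot a' a := by positivity
  refine ⟨nonneg_of_mul_nonneg_left (by linarith : 0 ≤ dot a' b * cross a' a) hh, ?_, ?_⟩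
  · have h1 : (cross a' b * dot a' a) ^ 2 ≤ (dot a' b * cross a' a) ^ 2 :=
      pow_le_pow_left₀ hp (by linarith) 2
    rw [← hNN]
    linear_combination h1 - cross a' b ^ 2 * hu
  · have h2 : cross b a ^ 2 ≤ (dot a' b * cross a' a) ^ 2 := pow_le_pow_left₀ hr (by linarith) 2
    have h3 : 0 ≤ cross a' b ^ 2 * cross a' a ^ 2 := by positivity
    rw [← hNN]
    linear_combination h2 + h3

theorem dot_dist_eq {l₁ : ℝ} {a b : ℂ} (ha : dot a a = 1) (hb : dot (b - a) (b - a) = l₁ ^ 2) :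
    dot a b = (dot b b + 1 - l₁ ^ 2) / 2 := by
  rw [dot_self_sub, ha, dot_comm b a] at hb; linarith

theorem cross_sq_lt {l₁ : ℝ} {a' a : ℂ} (ha' : dot a' a' = 1) (ha : dot a a = 1)
    (h₁ : l₁ < 1) (h₁' : 0 < l₁) (hβ : Real.cos (angleBeta l₁) < dot a' a) :
    cross a' a ^ 2 < l₁ ^ 2 := by
  have hβ2 := cos_angleBeta_sq h₁' h₁
  have hu := frame_sq ha' ha
  have := pow_lt_pow_left₀ hβ (cos_angleBeta_pos h₁' h₁).le two_ne_zero
  linarith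

/-- If the links of a weakly nested petal with angle less than `β` do not touch, then `B` satisfies
strict inequalities. -/
theorem WeaklyNestedPetal.strict_b {l₁ l₂ : ℝ} {a' a b c : ℂ}
    (h : WeaklyNestedPetal l₁ l₂ a' a b c) (h₁ : l₁ < 1) (h₁' : 0 < l₁)
    (ha' : dot a' a' = 1) (ha : dot a a = 1) (hb : dot (b - a) (b - a) = l₁ ^ 2)
    (hh : 0 < cross a' a) (hβ : Real.cos (angleBeta l₁) < dot a' a)
    (n₁ : b ∉ segment ℝ 0 a) (n₂ : b ∉ segment ℝ 0 a') :
    0 < cross a' b ∧ 0 < cross b a ∧ dot b b < 1 - l₁ ^ 2 := by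
  have hc0 : 0 < dot a' a := (cos_angleBeta_pos h₁' h₁).trans hβ
  have hk1 : 0 < l₁ ^ 2 := by positivity
  have hk0 : 0 < 1 - l₁ ^ 2 := by nlinarith
  have hhl := cross_sq_lt ha' ha h₁ h₁' hβ
  have hN := h.norm_b
  have hN0 := dot_self_nonneg b
  have hD := dot_dist_eq ha hb
  obtain ⟨hx0, hyh, hRh⟩ := cone_sq_le ha' ha hh hc0 h.left_b h.right_b
  refine ⟨lt_of_le_of_ne h.left_b fun he => n₂ ?_, lt_of_le_of_ne h.right_b fun he => n₁ ?_,
    lt_of_le_of_ne hN fun he => ?_⟩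
  · have hNN := dot_frame ha' b b
    have hx1 : dot a' b ≤ 1 := by
      by_contra hgt
      push Not at hgt
      rw [← he] at hNN
      nlinarith
    rw [eq_smul_of_cross_eq_zero ha' he.symm]
    exact smul_mem_segment hx0 hx1 _
  · rw [eq_smul_of_cross_eq_zero ha (z := b) (by rw [cross_swap, ← he, neg_zero])]
    exact smul_mem_segment (by rw [hD]; linarith) (by rw [hD]; linarith) _
  -- If OB² = 1 − l₁², the triangle OAB has a right angle at B, so AOB has sine l₁ and equals β,
  -- which exceeds the petal angle containing it.
  · have hDR := dot_frame ha b b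
    rw [he] at hD hRh hDR
    have e : cross b a ^ 2 = l₁ ^ 2 * (1 - l₁ ^ 2) := by
      rw [hD] at hDR
      rw [cross_swap]
      linear_combination -hDR
    rw [e] at hRh
    have := mul_lt_mul_of_pos_right hhl hk0
    linarith

theorem eq_or_eq_neg_of_dot_eq_zero {r : ℝ} {u v : ℂ} (hu : dot u u = 1) (hv : dot v v = r ^ 2)
    (h : dot u v = 0) : cross u v = r ∨ cross u v = -r := by
  have h1 := dot_frame hu v v
  rw [hv, h, zero_mul, zero_add] at h1
  exact sq_eq_sq_iff_eq_or_eq_neg.1 (by linarith)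

/-- A weakly nested petal with angle less than `β` whose links do not touch is nested. -/
theorem WeaklyNestedPetal.nested {l₁ l₂ : ℝ} {a' a b c : ℂ} (h : WeaklyNestedPetal l₁ l₂ a' a b c)
    (h₁ : l₁ < 1) (h₁' : 0 < l₁) (h₂ : 0 < l₂)
    (hl : Real.sin (angleBeta l₁) * Real.cos (angleBeta l₁) < l₂)
    (ha' : dot a' a' = 1) (ha : dot a a = 1) (hb : dot (b - a) (b - a) = l₁ ^ 2)
    (hc : dot (c - b) (c - b) = l₂ ^ 2)
    (hh : 0 < cross a' a) (hβ : Real.cos (angleBeta l₁) < dot a' a)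
    (n₁ : b ∉ segment ℝ 0 a) (n₂ : b ∉ segment ℝ 0 a') (n₃ : c ∉ segment ℝ 0 a')
    (n₄ : c ∉ segment ℝ 0 a) : NestedPetal l₁ a' a b c := by
  have hβ0 := cos_angleBeta_pos h₁' h₁
  have hβ2 := cos_angleBeta_sq h₁' h₁
  rw [sin_angleBeta h₁' h₁] at hl
  obtain ⟨hys, hrs, hNs⟩ := h.strict_b h₁ h₁' ha' ha hb hh hβ n₁ n₂
  obtain ⟨hx0, hyh, hRh⟩ := cone_sq_le ha' ha hh (hβ0.trans hβ) h.left_b h.right_b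
  have hD := dot_dist_eq ha hb
  have hk1 : 0 < l₁ ^ 2 := by positivity
  -- The distance from B to either side is at most OB · sin θ < cos β · sin β < l₂.
  have hNk : cross a' a ^ 2 * dot b b < l₂ ^ 2 := by
    have h2 : (l₁ * Real.cos (angleBeta l₁)) ^ 2 < l₂ ^ 2 :=
      pow_lt_pow_left₀ hl (by positivity) two_ne_zero
    rw [mul_pow, hβ2] at h2
    exact (mul_le_mul (cross_sq_lt ha' ha h₁ h₁' hβ).le hNs.le (dot_self_nonneg b)
      hk1.le).trans_lt h2
  have hRl : cross b a < l₂ := lt_of_pow_lt_pow_left₀ 2 h₂.le (hRh.trans_lt hNk)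
  have hyl : cross a' b < l₂ := lt_of_pow_lt_pow_left₀ 2 h₂.le (hyh.trans_lt hNk)
  have hx1 : dot a' b ≤ 1 := by
    have hNN := dot_frame ha' b b
    by_contra hgt
    push Not at hgt
    nlinarith [sq_nonneg (cross a' b)]
  refine ⟨hh, hβ, hys, hrs, hNs, ?_, ?_, ?_, ?_⟩
  · refine lt_of_le_of_ne h.left_c fun he => n₃ ?_
    have e := eq_smul_of_cross_eq_zero ha' he.symm
    have h1 := h.right_c
    rw [cross_frame ha' c a, ← he, zero_mul, sub_zero] at h1
    rw [e]
    exact smul_mem_segment (nonneg_of_mul_nonneg_left h1 hh) (h.dot_left.trans hx1) _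
  · refine lt_of_le_of_ne h.right_c fun he => n₄ ?_
    have he' : cross a c = 0 := by rw [cross_swap, ← he, neg_zero]
    have e := eq_smul_of_cross_eq_zero ha he'
    have h1 := h.left_c
    rw [cross_frame ha a' c, he', mul_zero, zero_sub, cross_swap a a', neg_mul, neg_neg] at h1
    rw [e]
    exact smul_mem_segment (nonneg_of_mul_nonneg_right h1 hh)
      (h.dot_right.trans (by rw [hD]; linarith)) _
  -- Now BC is perpendicular to OA'. If C is on the side of B away from OA', it violates the other
  -- perpendicular bound; if it is on the near side, it passes beyond OA', because B is closer than
  -- l₂ to that line. The last case is the mirror image.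
  · refine lt_of_le_of_ne h.dot_left fun he => ?_
    have h0 : dot a' (c - b) = 0 := by rw [dot_sub, he, sub_self]
    have h3 := dot_frame ha' a (c - b)
    rw [h0, mul_zero, zero_add, dot_sub] at h3
    rcases eq_or_eq_neg_of_dot_eq_zero ha' hc h0 with h6 | h6
    · rw [h6] at h3
      have := mul_pos hh h₂
      linarith [h.dot_right]
    · rw [cross_sub] at h6
      linarith [h.left_c]
  · refine lt_of_le_of_ne h.dot_right fun he => ?_
    have h0 : dot a (c - b) = 0 := by rw [dot_sub, he, sub_self]
    have h3 := dot_frame ha a' (c - b)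
    rw [h0, mul_zero, zero_add, dot_sub, cross_swap a a'] at h3
    rcases eq_or_eq_neg_of_dot_eq_zero ha hc h0 with h6 | h6
    · rw [cross_sub, cross_swap a c, cross_swap a b] at h6
      linarith [h.right_c]
    · rw [h6] at h3
      have := mul_pos hh h₂
      linarith [h.dot_left]

/-! ### Closed petal trees stay closed -/

theorem Lockable.l₂_lt_one {n : ℕ} {l₁ l₂ : ℝ} (h : Lockable n l₁ l₂) : l₂ < 1 := by
  have := h.l₂_lt
  have h1 := Real.cos_le_one (2 * Real.pi / n)
  have h2 := Real.sqrt_nonneg (l₁ ^ 2 - Real.sin (2 * Real.pi / n) ^ 2)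
  rw [distP] at this
  linarith

theorem Lockable.cos_angleMin_lt {n : ℕ} {l₁ l₂ : ℝ} (h : Lockable n l₁ l₂) :
    Real.cos (angleMin l₁ l₂) < Real.cos (angleAlpha n l₁) := by
  apply Real.cos_lt_cos_of_nonneg_of_le_pi _ (Real.arccos_le_pi _) h.alpha_lt_min
  have h1 := h.four_lt
  have h2 : (4 : ℝ) < n := by exact_mod_cast h1
  have h3 := angleBeta_lt h.l₁_lt_one
  have := Real.pi_pos
  exact div_nonneg (by linarith) (by linarith)

theorem angleAlpha_pos {n : ℕ} {l₁ : ℝ} (hn : 1 < n) (h₁ : l₁ < 1) : 0 < angleAlpha n l₁ := by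
  have h2 : (1 : ℝ) < n := by exact_mod_cast hn
  have h3 := angleBeta_lt h₁
  have := Real.pi_pos
  exact div_pos (by linarith) (by linarith)

/-- The linkage of a single petal tree. -/
def petalTree (n : ℕ) (l₁ l₂ : ℝ) (h₁ : 0 < l₁) (h₂ : 0 < l₂) : Linkage (Joint n) where
  graph :=
    { Adj := petalAdj
      symm := ⟨fun _ _ h => petalAdj_symm h⟩
      loopless := ⟨fun x h => petalAdj_irrefl x h⟩ }
  len := petalLen l₁ l₂
  len_comm := petalLen_comm l₁ l₂
  len_pos := fun x y _ => petalLen_pos h₁ h₂ x y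

theorem segment_sub_mem {o x y : ℂ} : y - o ∈ segment ℝ 0 (x - o) ↔ y ∈ segment ℝ o x := by
  have := mem_segment_translate ℝ (-o) (x := y) (b := o) (c := x)
  rw [← this]
  simp [sub_eq_neg_add]

section
variable {n : ℕ} {l₁ l₂ : ℝ} {h₁ : 0 < l₁} {h₂ : 0 < l₂} {p : Joint n → ℂ}

theorem Linkage.IsSimple.norm_A (hp : (petalTree n l₁ l₂ h₁ h₂).IsSimple p) (i : Fin n) :
    ‖p (.A i) - p .O‖ = 1 := by
  have := hp.dist_eq (.A i) .O trivial
  rwa [dist_eq_norm] at this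

theorem Linkage.IsSimple.dist_B (hp : (petalTree n l₁ l₂ h₁ h₂).IsSimple p) (i : Fin n) :
    dist (p (.B i)) (p (.A i)) = l₁ :=
  hp.dist_eq (.B i) (.A i) rfl

theorem Linkage.IsSimple.dist_C (hp : (petalTree n l₁ l₂ h₁ h₂).IsSimple p) (i : Fin n) :
    dist (p (.C i)) (p (.B i)) = l₂ :=
  hp.dist_eq (.C i) (.B i) rfl

end

section
variable {n : ℕ} [NeZero n] {l₁ l₂ : ℝ}

/-- The relative position of a petal satisfies the inequalities of a nested petal. -/
def IsNested (l₁ : ℝ) (p : Joint n → ℂ) (i : Fin n) : Prop :=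
  NestedPetal l₁ (p (.A (i - 1)) - p .O) (p (.A i) - p .O) (p (.B i) - p .O) (p (.C i) - p .O)

/-- The relative position of a petal satisfies the weak inequalities. -/
def IsWeaklyNested (l₁ l₂ : ℝ) (p : Joint n → ℂ) (i : Fin n) : Prop :=
  WeaklyNestedPetal l₁ l₂ (p (.A (i - 1)) - p .O) (p (.A i) - p .O) (p (.B i) - p .O)
    (p (.C i) - p .O)

variable {h₁ : 0 < l₁} {h₂ : 0 < l₂} {p : Joint n → ℂ}

theorem dot_sub_sub {o x y : ℂ} {r : ℝ} (h : dist x y = r) :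
    dot ((x - o) - (y - o)) ((x - o) - (y - o)) = r ^ 2 := by
  rw [sub_sub_sub_cancel_right, dot_self, ← dist_eq_norm, h]

/-- The arc and the quadrilateral are replaced by the inequalities that cut them out. The angle 0
must be excluded on the left, since `IsRestricted` only bounds the angle above. -/
theorem isRestricted_iff (hp : (petalTree n l₁ l₂ h₁ h₂).IsSimple p) (h1 : l₁ < 1) (i : Fin n) :
    (petalAngle p i ∈ Set.Ioo 0 (angleBeta l₁) ∧ IsRestricted l₁ p i) ↔ IsNested l₁ p i := by
  have hA' := hp.norm_A (i - 1)
  have hA := hp.norm_A i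
  have ha' := dot_self_eq_one hA'
  have ha := dot_self_eq_one hA
  have hB := hp.dist_B i
  obtain ⟨hc, hs⟩ := cos_ccwAngle hA' hA
  have hβ := cos_angleBeta_pos h₁ h1
  have hθ := mem_Ioo_iff (angleBeta_lt h1) (angleBeta_pos h₁) (ccwAngle_mem _ _ _) hc hs
  have hfoot : ∀ X : ℂ, ‖X - p .O‖ = 1 → foot (p .O) X (p (.B i)) =
      p .O + dot (X - p .O) (p (.B i) - p .O) • (X - p .O) := by
    intro X hX
    have : inner ℝ (X - p .O) (p (.B i) - p .O) = dot (X - p .O) (p (.B i) - p .O) := by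
      rw [Complex.inner]; simp [dot]; ring
    rw [foot, hX, this]; simp
  change (ccwAngle (p .O) (p (.A (i - 1))) (p (.A i)) ∈ _ ∧ _) ↔ _
  rw [IsRestricted, petalAngle, hfoot _ hA', hfoot _ hA]
  have e : ∀ x, p x = p .O + (p x - p .O) := fun x => by ring
  have hb : dist (p .O + (p (.B i) - p .O)) (p .O + (p (.A i) - p .O)) = l₁ := by
    rw [← e, ← e, hB]
  have key : 0 < cross (p (.A (i - 1)) - p .O) (p (.A i) - p .O) →
      Real.cos (angleBeta l₁) < dot (p (.A (i - 1)) - p .O) (p (.A i) - p .O) → _ :=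
    fun u v => mem_openArc_iff (b := p (.B i) - p .O) (o := p .O) h₁ h1 ha' ha hc hs u v hb
  have key2 : 0 < cross (p (.A (i - 1)) - p .O) (p (.A i) - p .O) →
      Real.cos (angleBeta l₁) < dot (p (.A (i - 1)) - p .O) (p (.A i) - p .O) → _ → _ → _ :=
    fun u v => mem_interior_quadrilateral_iff (b := p (.B i) - p .O) (c := p (.C i) - p .O)
      (o := p .O) ha' ha (hβ.trans v) u
  rw [← e, ← e] at key
  rw [← e, ← e] at key2
  constructor
  · rintro ⟨ht, -, hB', hC⟩
    obtain ⟨u, v⟩ := hθ.1 ht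
    obtain ⟨b1, b2, b3⟩ := (key u v).1 hB'
    obtain ⟨c1, c2, c3, c4⟩ := (key2 u v b1 b2).1 hC
    exact ⟨u, v, b1, b2, b3, c1, c2, c3, c4⟩
  · rintro ⟨u, v, b1, b2, b3, c1, c2, c3, c4⟩
    have ht := hθ.2 ⟨u, v⟩
    exact ⟨ht, ht.2, (key u v).2 ⟨b1, b2, b3⟩, (key2 u v b1 b2).2 ⟨c1, c2, c3, c4⟩⟩

theorem IsNested.dot_lt {n' : ℕ} (hL : Lockable n' l₁ l₂)
    (hp : (petalTree n l₁ l₂ h₁ h₂).IsSimple p) {i : Fin n} (h : IsNested l₁ p i) :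
    dot (p (.A (i - 1)) - p .O) (p (.A i) - p .O) < Real.cos (angleMin l₁ l₂) :=
  NestedPetal.dot_lt h hL.l₁_lt_one h₁ h₂ hL.l₂_lt_one hL.one_lt_add
    (dot_self_eq_one (hp.norm_A _)) (dot_self_eq_one (hp.norm_A _))
    (dot_sub_sub (hp.dist_B i)) (dot_sub_sub (hp.dist_C i))

/-- The lower bound α in the definition of a closed tree is automatic: nested petals have angle
greater than θₘ, and θₘ > α. -/
theorem isClosedTree_iff (hL : Lockable n l₁ l₂) (hp : (petalTree n l₁ l₂ h₁ h₂).IsSimple p) :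
    IsClosedTree l₁ p ↔ ∀ i, IsNested l₁ p i := by
  have hα : 0 < angleAlpha n l₁ := angleAlpha_pos (by have := hL.four_lt; omega) hL.l₁_lt_one
  refine forall_congr' fun i => ?_
  rw [← isRestricted_iff hp hL.l₁_lt_one]
  refine ⟨fun h => ⟨⟨hα.trans h.1.1, h.1.2⟩, h.2⟩, fun h => ⟨⟨?_, h.1.2⟩, h.2⟩⟩
  have hN := (isRestricted_iff hp hL.l₁_lt_one i).1 h
  have h1 := (hN.dot_lt hL hp).trans hL.cos_angleMin_lt
  rw [← (cos_ccwAngle (hp.norm_A (i - 1)) (hp.norm_A i)).1] at h1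
  by_contra hle
  push Not at hle
  have hαpi : angleAlpha n l₁ ≤ Real.pi := hL.alpha_lt_min.le.trans (Real.arccos_le_pi _)
  have := Real.cos_le_cos_of_nonneg_of_le_pi h.1.1.le hαpi hle
  exact absurd h1 (not_lt.2 this)

/-- The petal angles add up to a multiple of `2π`. -/
theorem sum_petalAngle (hp : (petalTree n l₁ l₂ h₁ h₂).IsSimple p) :
    ∃ m : ℤ, ∑ i, petalAngle p i = m * (2 * Real.pi) := by
  have h0 : ∀ i, p (.A i) - p .O ≠ 0 := fun i => by
    rw [← norm_ne_zero_iff, hp.norm_A]; norm_num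
  have h : Complex.exp ((∑ i, petalAngle p i : ℝ) * Complex.I) = 1 := by
    push_cast
    rw [Finset.sum_mul, Complex.exp_sum]
    have : ∀ i, Complex.exp (petalAngle p i * Complex.I) =
        (p (.A i) - p .O) / (p (.A (i - 1)) - p .O) := by
      intro i
      rw [← exp_ccwAngle, norm_div, hp.norm_A, hp.norm_A]
      simp [petalAngle]
    simp only [this]
    -- The quotients of consecutive unit vectors telescope around the cycle.
    rw [Finset.prod_div_distrib, show ∏ i, (p (.A (i - 1)) - p .O) = ∏ i, (p (.A i) - p .O) from
      (Equiv.subRight (1 : Fin n)).prod_comp (fun i => p (.A i) - p .O),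
      div_self (Finset.prod_ne_zero_iff.2 fun i _ => h0 i)]
  obtain ⟨m, hm⟩ := Complex.exp_eq_one_iff.1 h
  refine ⟨m, ?_⟩
  have h2 : ((∑ i, petalAngle p i : ℝ) : ℂ) * Complex.I =
      ((m * (2 * Real.pi) : ℝ) : ℂ) * Complex.I := by rw [hm]; push_cast; ring
  exact_mod_cast mul_right_cancel₀ Complex.I_ne_zero h2

end

section
variable {l₁ l₂ : ℝ} {h₁ : 0 < l₁} {h₂ : 0 < l₂} {p : Joint 8 → ℂ}

/-- The only step in which the petals act together. Pinching a single petal open to angle β is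
prevented by the minimal angle θₘ of the other seven; the rest concerns one petal at a time. -/
theorem IsWeaklyNested.isNested (hL : Lockable 8 l₁ l₂)
    (hp : (petalTree 8 l₁ l₂ h₁ h₂).IsSimple p) (h : ∀ i, IsWeaklyNested l₁ l₂ p i) (i : Fin 8) :
    IsNested l₁ p i := by
  have hl := hL.l₁_lt_one
  have hβ := cos_angleBeta_pos h₁ hl
  have hβ' := angleBeta_lt hl
  have hαm := hL.alpha_lt_min
  have hmpi : angleMin l₁ l₂ ≤ Real.pi := Real.arccos_le_pi _
  have hpi := Real.pi_pos
  have hα : 0 < angleAlpha 8 l₁ := angleAlpha_pos (by norm_num) hl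
  have hcs := fun i => cos_ccwAngle (hp.norm_A (i - 1)) (hp.norm_A i)
  have hang : ∀ i, petalAngle p i ∈ Set.Icc (angleMin l₁ l₂) (angleBeta l₁) := by
    intro i
    obtain ⟨hc, hs⟩ := hcs i
    have hθ := ccwAngle_mem (p .O) (p (.A (i - 1))) (p (.A i))
    have w := h i
    change ccwAngle (p .O) (p (.A (i - 1))) (p (.A i)) ∈ _
    set θ := ccwAngle (p .O) (p (.A (i - 1))) (p (.A i))
    have hle : θ ≤ Real.pi := by
      by_contra hgt
      push Not at hgt
      have h3 : Real.sin θ < 0 := by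
        rw [← Real.sin_sub_two_pi]
        exact Real.sin_neg_of_neg_of_neg_pi_lt (by linarith [hθ.2]) (by linarith)
      rw [hs] at h3
      linarith [w.cross_nonneg]
    constructor
    · by_contra hlt
      push Not at hlt
      have := Real.cos_lt_cos_of_nonneg_of_le_pi hθ.1 hmpi hlt
      rw [hc] at this
      linarith [w.dot_le]
    · by_contra hlt
      push Not at hlt
      have := Real.cos_lt_cos_of_nonneg_of_le_pi (angleBeta_pos h₁).le hle hlt
      rw [hc] at this
      linarith [w.le_dot]
  -- Eight petals matter here: 8β < 4π because β < π/2, so the winding number can only be 1.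
  have hsum : ∑ i, petalAngle p i = 2 * Real.pi := by
    obtain ⟨m, hm⟩ := sum_petalAngle hp
    have hlo : 0 < ∑ i, petalAngle p i :=
      Finset.sum_pos (fun i _ => by linarith [(hang i).1]) Finset.univ_nonempty
    have hhi : ∑ i, petalAngle p i ≤ ∑ _i : Fin 8, angleBeta l₁ :=
      Finset.sum_le_sum fun i _ => (hang i).2
    simp only [Finset.sum_const, Finset.card_univ, Fintype.card_fin, nsmul_eq_mul] at hhi
    push_cast at hhi
    rw [hm] at hlo hhi ⊢
    have m0 : (0 : ℝ) < m := by
      by_contra hle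
      push Not at hle
      nlinarith
    have m2 : (m : ℝ) < 2 := by
      by_contra hle
      push Not at hle
      nlinarith
    have : m = 1 := by
      have a : 0 < m := by exact_mod_cast m0
      have b : m < 2 := by exact_mod_cast m2
      omega
    rw [this]; simp
  have hlt : petalAngle p i < angleBeta l₁ := by
    refine lt_of_le_of_ne (hang i).2 fun he => ?_
    have hi := Finset.add_sum_erase Finset.univ (petalAngle p) (Finset.mem_univ i)
    -- The other seven angles sum to at least 7θₘ > 7α = 2π − β.
    have hge : ∑ _j ∈ Finset.univ.erase i, angleMin l₁ l₂ ≤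
        ∑ j ∈ Finset.univ.erase i, petalAngle p j := Finset.sum_le_sum fun j _ => (hang j).1
    simp only [Finset.sum_const, Finset.card_erase_of_mem (Finset.mem_univ i), Finset.card_univ,
      Fintype.card_fin, nsmul_eq_mul] at hge
    push_cast at hge
    rw [hsum, he] at hi
    have : angleAlpha 8 l₁ * 7 = 2 * Real.pi - angleBeta l₁ := by
      rw [angleAlpha]; push_cast; ring
    norm_num at hge
    linarith
  obtain ⟨hc, hs⟩ := hcs i
  have hpos : 0 < petalAngle p i := by linarith [(hang i).1]
  obtain ⟨hcr, hdt⟩ := (mem_Ioo_iff hβ' (angleBeta_pos h₁) (ccwAngle_mem _ _ _) hc hs).1 ⟨hpos, hlt⟩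
  have hne : i - 1 ≠ i := (by decide : ∀ i : Fin 8, i - 1 ≠ i) i
  have hd : ∀ x y z w, petalAdj x y → petalAdj z w → x ≠ z → x ≠ w → y ≠ z → y ≠ w →
      ∀ u ∈ segment ℝ (p x) (p y), u ∉ segment ℝ (p z) (p w) := fun x y z w a b c d e f u hu hu' =>
    Set.disjoint_left.1 (hp.disjoint x y z w a b c d e f) hu hu'
  refine WeaklyNestedPetal.nested (h i) hl h₁ h₂ hL.lt_l₂ (dot_self_eq_one (hp.norm_A _))
    (dot_self_eq_one (hp.norm_A _)) (dot_sub_sub (hp.dist_B i)) (dot_sub_sub (hp.dist_C i)) hcr hdt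
    ?_ ?_ ?_ ?_ <;> rw [segment_sub_mem]
  · intro hb
    have hm := hp.incident (.A i) .O (.B i) trivial rfl (by simp)
    have : p (.B i) ∈ ({p (.A i)} : Set ℂ) := by
      rw [← hm]
      exact ⟨by rwa [segment_symm], right_mem_segment ℝ _ _⟩
    have hB := hp.dist_B i
    rw [Set.mem_singleton_iff.1 this, dist_self] at hB
    exact h₁.ne hB
  · exact hd (.A i) (.B i) .O (.A (i - 1)) rfl trivial (by simp) (by simp [hne.symm]) (by simp)
      (by simp) _ (right_mem_segment ℝ _ _)
  · exact hd (.B i) (.C i) .O (.A (i - 1)) rfl trivial (by simp) (by simp) (by simp)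
      (by simp) _ (right_mem_segment ℝ _ _)
  · exact hd (.B i) (.C i) .O (.A i) rfl trivial (by simp) (by simp) (by simp)
      (by simp) _ (right_mem_segment ℝ _ _)

/-! ### The open-and-closed argument along a motion -/

theorem continuous_dot {X : Type*} [TopologicalSpace X] {f g : X → ℂ} (hf : Continuous f)
    (hg : Continuous g) : Continuous fun t => dot (f t) (g t) := by
  simp only [dot]; fun_prop

theorem continuous_cross {X : Type*} [TopologicalSpace X] {f g : X → ℂ} (hf : Continuous f)
    (hg : Continuous g) : Continuous fun t => cross (f t) (g t) := by
  simp only [cross]; fun_prop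

/-- A continuous movement of a petal tree through simple configurations that starts closed remains
closed. -/
theorem isClosedTree_of_path (hL : Lockable 8 l₁ l₂) {γ : unitInterval → Joint 8 → ℂ}
    (hγ : Continuous γ) (hs : ∀ t, (petalTree 8 l₁ l₂ h₁ h₂).IsSimple (γ t))
    (h0 : IsClosedTree l₁ (γ 0)) (t : unitInterval) : IsClosedTree l₁ (γ t) := by
  have hcoord : ∀ x, Continuous fun t => γ t x - γ t .O := fun x => by fun_prop
  have hd := fun x y => continuous_dot (hcoord x) (hcoord y)
  have hc := fun x y => continuous_cross (hcoord x) (hcoord y)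
  have hopen : IsOpen {t | ∀ i, IsNested l₁ (γ t) i} := by
    rw [Set.ofPred_forall]
    refine isOpen_iInter_of_finite fun i => ?_
    have : {t | IsNested l₁ (γ t) i} = _ :=
      Set.ext fun t => ⟨fun ⟨a1, a2, a3, a4, a5, a6, a7, a8, a9⟩ =>
          (⟨a1, a2, a3, a4, a5, a6, a7, a8, a9⟩ : _ ∧ _ ∧ _ ∧ _ ∧ _ ∧ _ ∧ _ ∧ _ ∧ _),
        fun ⟨a1, a2, a3, a4, a5, a6, a7, a8, a9⟩ => ⟨a1, a2, a3, a4, a5, a6, a7, a8, a9⟩⟩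
    rw [this]
    refine IsOpen.and ?_ (IsOpen.and ?_ (IsOpen.and ?_ (IsOpen.and ?_ (IsOpen.and ?_
      (IsOpen.and ?_ (IsOpen.and ?_ (IsOpen.and ?_ ?_))))))) <;>
    first
    | exact isOpen_lt continuous_const (hc _ _)
    | exact isOpen_lt continuous_const (hd _ _)
    | exact isOpen_lt (hd _ _) continuous_const
    | exact isOpen_lt (hd _ _) (hd _ _)
  have hclosed : IsClosed {t | ∀ i, IsWeaklyNested l₁ l₂ (γ t) i} := by
    rw [Set.ofPred_forall]
    refine isClosed_iInter fun i => ?_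
    have : {t | IsWeaklyNested l₁ l₂ (γ t) i} = _ :=
      Set.ext fun t => ⟨fun ⟨a1, a2, a3, a4, a5, a6, a7, a8, a9, a10⟩ =>
          (⟨a1, a2, a3, a4, a5, a6, a7, a8, a9, a10⟩ :
            _ ∧ _ ∧ _ ∧ _ ∧ _ ∧ _ ∧ _ ∧ _ ∧ _ ∧ _),
        fun ⟨a1, a2, a3, a4, a5, a6, a7, a8, a9, a10⟩ =>
          ⟨a1, a2, a3, a4, a5, a6, a7, a8, a9, a10⟩⟩
    rw [this]
    refine IsClosed.and ?_ (IsClosed.and ?_ (IsClosed.and ?_ (IsClosed.and ?_ (IsClosed.and ?_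
      (IsClosed.and ?_ (IsClosed.and ?_ (IsClosed.and ?_ (IsClosed.and ?_ ?_)))))))) <;>
    first
    | exact isClosed_le continuous_const (hc _ _)
    | exact isClosed_le continuous_const (hd _ _)
    | exact isClosed_le (hd _ _) continuous_const
    | exact isClosed_le (hd _ _) (hd _ _)
  -- The strict conditions give an open set of times and the weak ones a closed set; simplicity
  -- makes them equal.
  have heq : {t | ∀ i, IsNested l₁ (γ t) i} = {t | ∀ i, IsWeaklyNested l₁ l₂ (γ t) i} :=
    Set.ext fun t => ⟨fun h i => NestedPetal.weakly (h i) ((h i).dot_lt hL (hs t)),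
      fun h => IsWeaklyNested.isNested hL (hs t) h⟩
  have huniv := IsClopen.eq_univ ⟨heq ▸ hclosed, hopen⟩ ⟨0, (isClosedTree_iff hL (hs 0)).1 h0⟩
  rw [isClosedTree_iff hL (hs t)]
  exact (Set.ext_iff.1 huniv t).2 trivial

end

theorem IsClosedTree.not_isOpenTree {n : ℕ} [NeZero n] {l₁ : ℝ} {p : Joint n → ℂ}
    (h : IsClosedTree l₁ p) : ¬ IsOpenTree l₁ p :=
  fun ⟨i, hi⟩ => lt_asymm hi (h i).1.1

/-! ### Trees given by a parent function -/

/-- The graph `G` is the graph of the links from each vertex other than `r` to its parent. -/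
structure IsParentTree {V : Type*} (G : SimpleGraph V) (r : V) (par : V → V) (rank : V → ℕ) :
    Prop where
  rank_lt : ∀ x, x ≠ r → rank (par x) < rank x
  adj_iff : ∀ x y, G.Adj x y ↔ (x ≠ r ∧ par x = y) ∨ (y ≠ r ∧ par y = x)

/-- Following parents lowers the rank and so reaches the root, which gives connectedness. Edges
correspond to non-root vertices, so the edge count makes the graph a tree. -/
theorem IsParentTree.isTree {V : Type*} [Finite V] {G : SimpleGraph V} {r : V} {par : V → V}
    {rank : V → ℕ} (h : IsParentTree G r par rank) :
    G.IsTree ∧ G.edgeSet.ncard + 1 = Nat.card V := by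
  have hreach : ∀ n x, rank x ≤ n → G.Reachable x r := by
    intro n
    induction n with
    | zero =>
      intro x hx
      by_cases hr : x = r
      · rw [hr]
      · have := h.rank_lt x hr
        omega
    | succ n ih =>
      intro x hx
      by_cases hr : x = r
      · rw [hr]
      · have := h.rank_lt x hr
        have hadj : G.Adj x (par x) := (h.adj_iff _ _).2 (Or.inl ⟨hr, rfl⟩)
        exact hadj.reachable.trans (ih _ (by omega))
  have hconn : G.Connected := by
    have : Nonempty V := ⟨r⟩
    exact ⟨fun x y => (hreach _ x le_rfl).trans (hreach _ y le_rfl).symm⟩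
  have himg : G.edgeSet = (fun x => s(x, par x)) '' {x | x ≠ r} := by
    ext e
    induction e using Sym2.ind with
    | _ x y =>
      rw [SimpleGraph.mem_edgeSet, h.adj_iff]
      constructor
      · rintro (⟨h1, rfl⟩ | ⟨h1, rfl⟩)
        · exact ⟨x, h1, rfl⟩
        · exact ⟨y, h1, Sym2.eq_swap⟩
      · rintro ⟨z, hz, he⟩
        rcases Sym2.eq_iff.1 he with ⟨rfl, rfl⟩ | ⟨rfl, rfl⟩
        · exact Or.inl ⟨hz, rfl⟩
        · exact Or.inr ⟨hz, rfl⟩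
  -- Two different vertices with the same parent edge would be parents of each other, which the rank
  -- forbids.
  have hinj : Set.InjOn (fun x => s(x, par x)) {x | x ≠ r} := by
    intro x hx y hy he
    rcases Sym2.eq_iff.1 he with ⟨h1, -⟩ | ⟨h1, h2⟩
    · exact h1
    · have a := h.rank_lt x hx
      have b := h.rank_lt y hy
      rw [h2] at a
      rw [← h1] at b
      omega
  have hcard : G.edgeSet.ncard + 1 = Nat.card V := by
    rw [himg, hinj.ncard_image]
    have h1 : {x | x ≠ r} = ({r} : Set V)ᶜ := rfl
    rw [h1, ← Set.ncard_add_ncard_compl {r}, Set.ncard_singleton, add_comm]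
  exact ⟨SimpleGraph.isTree_iff_connected_and_card.2 ⟨hconn, hcard⟩, hcard⟩

/-- A set of vertices that contains the root and is closed under parents again spans a tree. -/
theorem IsParentTree.comap {V W : Type*} {G : SimpleGraph V} {r : V} {par : V → V}
    {rank : V → ℕ} (h : IsParentTree G r par rank) {f : W → V} (hf : f.Injective) {r' : W}
    {par' : W → W} (hr : f r' = r) (hpar : ∀ x, f (par' x) = par (f x)) :
    IsParentTree (G.comap f) r' par' (fun x => rank (f x)) where
  rank_lt x hx := by
    rw [hpar]
    exact h.rank_lt _ (fun e => hx (hf (e.trans hr.symm)))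
  adj_iff x y := by
    rw [SimpleGraph.comap_adj, h.adj_iff, ← hr, ← hpar, ← hpar]
    simp [hf.eq_iff]

/-- To check that a placement of a tree is simple, it suffices to consider the links to parents. -/
theorem IsParentTree.isSimple {V : Type*} {T : Linkage V} {r : V} {par : V → V}
    {rank : V → ℕ} (h : IsParentTree T.graph r par rank) {p : V → ℂ}
    (hd : ∀ x, x ≠ r → dist (p x) (p (par x)) = T.len x (par x))
    (hi : ∀ x y, x ≠ r → y ≠ r → x ≠ y → ∀ z ∈ segment ℝ (p x) (p (par x)),
      z ∈ segment ℝ (p y) (p (par y)) →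
        ∃ v, (v = x ∨ v = par x) ∧ (v = y ∨ v = par y) ∧ z = p v) : T.IsSimple p := by
  have key : ∀ x y, T.graph.Adj x y → ∃ e, e ≠ r ∧
      segment ℝ (p x) (p y) = segment ℝ (p e) (p (par e)) ∧
      (∀ v, (v = e ∨ v = par e) ↔ (v = x ∨ v = y)) := by
    intro x y hxy
    rcases (h.adj_iff x y).1 hxy with ⟨h1, rfl⟩ | ⟨h1, rfl⟩
    · exact ⟨x, h1, rfl, fun v => Iff.rfl⟩
    · exact ⟨y, h1, segment_symm ℝ _ _, fun v => or_comm⟩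
  have inter : ∀ x y z w, T.graph.Adj x y → T.graph.Adj z w → (∃ v, (v = x ∨ v = y) ∧
      ¬ (v = z ∨ v = w)) → ∀ u ∈ segment ℝ (p x) (p y), u ∈ segment ℝ (p z) (p w) →
        ∃ v, (v = x ∨ v = y) ∧ (v = z ∨ v = w) ∧ u = p v := by
    intro x y z w hxy hzw ⟨v, hv, hv'⟩ u hu hu'
    obtain ⟨e, he, hs, hm⟩ := key x y hxy
    obtain ⟨e', he', hs', hm'⟩ := key z w hzw
    rw [hs] at hu
    rw [hs'] at hu'
    have hne : e ≠ e' := by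
      rintro rfl
      exact hv' ((hm' v).1 ((hm v).2 hv))
    obtain ⟨v', h1, h2, h3⟩ := hi e e' he he' hne u hu hu'
    exact ⟨v', (hm v').1 h1, (hm' v').1 h2, h3⟩
  refine ⟨?_, ?_, ?_⟩
  · intro x y hxy
    rcases (h.adj_iff x y).1 hxy with ⟨h1, rfl⟩ | ⟨h1, rfl⟩
    · exact hd x h1
    · rw [dist_comm, T.len_comm]
      exact hd y h1
  · intro x y z hxy hxz hyz
    apply Set.Subset.antisymm
    · rintro u ⟨hu, hu'⟩
      obtain ⟨v, h1, h2, h3⟩ := inter x y x z hxy hxz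
        ⟨y, Or.inr rfl, not_or.2 ⟨hxy.ne', hyz⟩⟩ u hu hu'
      have : v = x := by
        rcases h1 with h1 | h1
        · exact h1
        · rcases h2 with h2 | h2
          · exact h2
          · exact absurd (h1.symm.trans h2) hyz
      rw [h3, this]; rfl
    · rintro u rfl
      exact ⟨left_mem_segment ℝ _ _, left_mem_segment ℝ _ _⟩
  · intro x y z w hxy hzw h1 h2 h3 h4
    refine Set.disjoint_left.2 fun u hu hu' => ?_
    obtain ⟨v, hv, hv', -⟩ := inter x y z w hxy hzw ⟨x, Or.inl rfl, not_or.2 ⟨h1, h2⟩⟩ u hu hu'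
    rcases hv with rfl | rfl
    · exact hv'.elim h1 h2
    · exact hv'.elim h3 h4

/-! ### Sublinkages and motions -/

theorem Linkage.IsSimple.comp {V W : Type*} {T : Linkage V} {T' : Linkage W} {p : V → ℂ}
    (h : T.IsSimple p) {f : W → V} (hf : f.Injective)
    (hadj : ∀ x y, T'.graph.Adj x y → T.graph.Adj (f x) (f y))
    (hlen : ∀ x y, T'.graph.Adj x y → T.len (f x) (f y) = T'.len x y) :
    T'.IsSimple (p ∘ f) where
  dist_eq x y hxy := by rw [← hlen x y hxy]; exact h.dist_eq _ _ (hadj x y hxy)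
  incident x y z hxy hxz hyz :=
    h.incident _ _ _ (hadj x y hxy) (hadj x z hxz) (hf.ne hyz)
  disjoint x y z w hxy hzw h1 h2 h3 h4 :=
    h.disjoint _ _ _ _ (hadj x y hxy) (hadj z w hzw) (hf.ne h1) (hf.ne h2) (hf.ne h3) (hf.ne h4)

/-- The sublinkage induced on a set of joints. -/
def Linkage.comap {V W : Type*} (T : Linkage V) (f : W → V) : Linkage W where
  graph := T.graph.comap f
  len x y := T.len (f x) (f y)
  len_comm _ _ := T.len_comm _ _
  len_pos _ _ h := T.len_pos _ _ h

theorem Linkage.IsSimple.comap {V W : Type*} {T : Linkage V} {p : V → ℂ}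
    (h : T.IsSimple p) {f : W → V} (hf : f.Injective) : (T.comap f).IsSimple (p ∘ f) :=
  h.comp hf (fun _ _ h => h) (fun _ _ _ => rfl)

/-- A closed eight-petal subtree remains closed in any motion. -/
theorem isClosedTree_of_motion {W : Type*} {T : Linkage W} {l₁ l₂ : ℝ} (hL : Lockable 8 l₁ l₂)
    {e : Joint 8 → W} (he : e.Injective)
    (hadj : ∀ x y, petalAdj x y → T.graph.Adj (e x) (e y))
    (hlen : ∀ x y, petalAdj x y → T.len (e x) (e y) = petalLen l₁ l₂ x y)
    {p q : T.Configuration} (γ : T.Motion p q) (h0 : IsClosedTree l₁ (p.1 ∘ e))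
    (t : unitInterval) : IsClosedTree l₁ ((γ t).1 ∘ e) := by
  have hc : Continuous fun t => (γ t).1 := continuous_subtype_val.comp γ.continuous
  refine isClosedTree_of_path (γ := fun t => (γ t).1 ∘ e) (h₁ := hL.l₁_pos) (h₂ := hL.l₂_pos) hL
    (continuous_pi fun x => (continuous_apply (e x)).comp hc)
    (fun t => (γ t).2.comp he hadj hlen) ?_ t
  simpa using h0

theorem le_card_classes {W : Type*} {T : Linkage W} {k : ℕ}
    {p : (Fin k → Bool) → T.Configuration}
    (h : ∀ s s', s ≠ s' → ¬ T.Equivalent (p s) (p s')) :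
    ((2 ^ k : ℕ) : ℕ∞) ≤ ENat.card T.Classes := by
  have hinj : Function.Injective (fun s => (Quotient.mk _ (p s) : T.Classes)) := by
    intro s s' he
    by_contra hne
    exact h s s' hne (Quotient.exact he)
  have := ENat.card_le_card_of_injective hinj
  rwa [ENat.card_eq_coe_fintype_card, Fintype.card_pi_const, Fintype.card_bool] at this

/-- Placements in which corresponding petal subtrees are closed and open according to labels are
not equivalent if the labels differ. -/
theorem not_equivalent_of_labels {W : Type*} {T : Linkage W} {l₁ l₂ : ℝ} (hL : Lockable 8 l₁ l₂)
    {k : ℕ} {e : Fin k → Joint 8 → W} (he : ∀ j, (e j).Injective)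
    (hadj : ∀ j x y, petalAdj x y → T.graph.Adj (e j x) (e j y))
    (hlen : ∀ j x y, petalAdj x y → T.len (e j x) (e j y) = petalLen l₁ l₂ x y)
    {p : (Fin k → Bool) → T.Configuration}
    (hp : ∀ s j, (s j = false → IsClosedTree l₁ ((p s).1 ∘ e j)) ∧
      (s j = true → IsOpenTree l₁ ((p s).1 ∘ e j)))
    (s s' : Fin k → Bool) (hne : s ≠ s') : ¬ T.Equivalent (p s) (p s') := by
  have main : ∀ s s' j, s j = false → s' j = true → ¬ T.Equivalent (p s) (p s') := by
    rintro s s' j h1 h2 ⟨γ⟩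
    have := isClosedTree_of_motion hL (he j) (hadj j) (hlen j) γ ((hp s j).1 h1) 1
    rw [γ.target] at this
    exact this.not_isOpenTree ((hp s' j).2 h2)
  obtain ⟨j, hj⟩ := Function.ne_iff.1 hne
  cases h1 : s j
  · exact main s s' j h1 (by rw [h1] at hj; revert hj; cases s' j <;> simp)
  -- The closed copy is now in the target configuration, so the motion is reversed.
  · rintro ⟨γ⟩
    exact main s' s j (by rw [h1] at hj; revert hj; cases s' j <;> simp) h1 ⟨γ.symm⟩

/-! ### The chain of petal trees -/

/-- The joint before `x` on the way to the centre of the first copy. -/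
def chainParent {k n : ℕ} : Fin k × Joint n → Fin k × Joint n
  -- For the first centre truncated subtraction returns the centre itself. This value at the root
  -- plays no role in `IsParentTree`.
  | (j, .O) => (⟨j.val - 1, by omega⟩, .O)
  | (j, .A _) => (j, .O)
  | (j, .B i) => (j, .A i)
  | (j, .C i) => (j, .B i)

def chainRank {k n : ℕ} : Fin k × Joint n → ℕ
  | (j, .O) => j
  | (j, .A _) => j + 1
  | (j, .B _) => j + 2
  | (j, .C _) => j + 3

theorem isParentTree_chainGraph {k n : ℕ} (hk : 0 < k) :
    IsParentTree (chainGraph k n) (⟨0, hk⟩, .O) chainParent chainRank where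
  rank_lt := by
    rintro ⟨j, x⟩ hx
    cases x
    · simp only [chainParent, chainRank]
      have : j.val ≠ 0 := fun h => hx (by ext <;> simp [h])
      omega
    all_goals simp only [chainParent, chainRank]; omega
  adj_iff := by
    rintro ⟨j, x⟩ ⟨j', y⟩
    cases x <;> cases y <;>
      simp [chainGraph, chainParent, petalAdj, Fin.ext_iff, eq_comm] <;> omega

theorem card_joint (n : ℕ) : Nat.card (Joint n) = 3 * n + 1 := by
  let e : Joint n ≃ Option (Fin n ⊕ Fin n ⊕ Fin n) :=
    { toFun := fun x => match x with
        | .O => none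
        | .A i => some (.inl i)
        | .B i => some (.inr (.inl i))
        | .C i => some (.inr (.inr i))
      invFun := fun x => match x with
        | none => .O
        | some (.inl i) => .A i
        | some (.inr (.inl i)) => .B i
        | some (.inr (.inr i)) => .C i
      left_inv := by rintro (_ | _ | _ | _) <;> rfl
      right_inv := by rintro (_ | _ | _ | _) <;> rfl }
  rw [Nat.card_congr e]
  simp; ring

instance (n : ℕ) : Finite (Joint n) :=
  Nat.finite_of_card_ne_zero (by rw [card_joint]; omega)

theorem chain_isTree {k : ℕ} (hk : 1 ≤ k) :
    (chainGraph k 8).IsTree ∧ (chainGraph k 8).edgeSet.ncard = 24 * k + (k - 1) := by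
  obtain ⟨h1, h2⟩ := (isParentTree_chainGraph (n := 8) hk).isTree
  refine ⟨h1, ?_⟩
  rw [Nat.card_prod, card_joint, Nat.card_eq_fintype_card, Fintype.card_fin] at h2
  omega

/-- The joints of a chain of `m` centres of which the first `k` carry petals. -/
abbrev PartialChain (m k : ℕ) : Type := Fin m ⊕ Fin k × (Fin 8 ⊕ Fin 8 ⊕ Fin 8)

def partialInclusion {m k : ℕ} (h : k ≤ m) : PartialChain m k → Fin m × Joint 8
  | .inl j => (j, .O)
  | .inr (j, .inl i) => (j.castLE h, .A i)
  | .inr (j, .inr (.inl i)) => (j.castLE h, .B i)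
  | .inr (j, .inr (.inr i)) => (j.castLE h, .C i)

def partialParent {m k : ℕ} (h : k ≤ m) : PartialChain m k → PartialChain m k
  | .inl j => .inl ⟨j.val - 1, by omega⟩
  | .inr (j, .inl _) => .inl (j.castLE h)
  | .inr (j, .inr (.inl i)) => .inr (j, .inl i)
  | .inr (j, .inr (.inr i)) => .inr (j, .inr (.inl i))

def partialCopy {m k : ℕ} (h : k ≤ m) (j : Fin k) : Joint 8 → PartialChain m k
  | .O => .inl (j.castLE h)
  | .A i => .inr (j, .inl i)
  | .B i => .inr (j, .inr (.inl i))
  | .C i => .inr (j, .inr (.inr i))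

theorem partialInclusion_injective {m k : ℕ} (h : k ≤ m) :
    (partialInclusion h).Injective := by
  rintro (x | ⟨x, _ | _ | _⟩) (y | ⟨y, _ | _ | _⟩) <;> simp [partialInclusion]

theorem partialInclusion_partialCopy {m k : ℕ} (h : k ≤ m) (j : Fin k) (x : Joint 8) :
    partialInclusion h (partialCopy h j x) = (j.castLE h, x) := by
  cases x <;> rfl

/-- There are m + 24k joints. Varying m adjusts the number of links by single units, which whole
copies could not do. -/
theorem partialChain_isTree {m k : ℕ} (h : k ≤ m) (hm : 0 < m) :
    ((chainGraph m 8).comap (partialInclusion h)).IsTree ∧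
      ((chainGraph m 8).comap (partialInclusion h)).edgeSet.ncard + 1 = m + k * 24 := by
  have := ((isParentTree_chainGraph (n := 8) hm).comap (partialInclusion_injective h)
    (r' := .inl ⟨0, hm⟩) (par' := partialParent h) rfl
    (by rintro (x | ⟨x, _ | _ | _⟩) <;> rfl)).isTree
  simpa [Nat.card_eq_fintype_card] using this

theorem chain_len_copy {k : ℕ} {l₁ l₂ L : ℝ} (j : Fin k) (x y : Joint 8) (h : petalAdj x y) :
    chainLen l₁ l₂ L (j, x) (j, y) = petalLen l₁ l₂ x y := by
  cases x <;> cases y <;> simp_all [chainLen, petalAdj]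

theorem chain_adj_copy {k : ℕ} (j : Fin k) (x y : Joint 8) (h : petalAdj x y) :
    (chainGraph k 8).Adj (j, x) (j, y) := Or.inl ⟨rfl, h⟩

/-! ### Sectors -/

/-- The point with polar coordinates `ρ, ψ`. -/
def polar (ρ ψ : ℝ) : ℂ := ρ * Complex.exp (ψ * Complex.I)

theorem polar_re (ρ ψ : ℝ) : (polar ρ ψ).re = ρ * Real.cos ψ := by
  rw [polar, Complex.re_ofReal_mul, Complex.exp_ofReal_mul_I_re]

theorem polar_im (ρ ψ : ℝ) : (polar ρ ψ).im = ρ * Real.sin ψ := by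
  rw [polar, Complex.im_ofReal_mul, Complex.exp_ofReal_mul_I_im]

theorem dot_polar (ρ ψ σ χ : ℝ) : dot (polar ρ ψ) (polar σ χ) = ρ * σ * Real.cos (χ - ψ) := by
  simp only [dot, polar_re, polar_im, Real.cos_sub]; ring

theorem cross_polar (ρ ψ σ χ : ℝ) : cross (polar ρ ψ) (polar σ χ) = ρ * σ * Real.sin (χ - ψ) := by
  simp only [cross, polar_re, polar_im, Real.sin_sub]; ring

theorem norm_polar {ρ : ℝ} (h : 0 ≤ ρ) (ψ : ℝ) : ‖polar ρ ψ‖ = ρ := by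
  rw [polar, norm_mul, Complex.norm_exp_ofReal_mul_I, mul_one, Complex.norm_real,
    Real.norm_of_nonneg h]

theorem polar_smul (t ρ ψ : ℝ) : t • polar ρ ψ = polar (t * ρ) ψ := by
  simp [polar, mul_assoc]

theorem polar_add (ρ σ ψ : ℝ) : polar ρ ψ + polar σ ψ = polar (ρ + σ) ψ := by
  simp [polar, add_mul]

theorem polar_sub (ρ σ ψ : ℝ) : polar ρ ψ - polar σ ψ = polar (ρ - σ) ψ := by
  simp [polar, sub_mul]

theorem polar_add_two_pi (ρ ψ : ℝ) (m : ℤ) : polar ρ (ψ + m * (2 * Real.pi)) = polar ρ ψ := by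
  rw [polar, polar]
  push_cast
  rw [add_mul, Complex.exp_add, mul_assoc (m : ℂ), Complex.exp_int_mul_two_pi_mul_I, mul_one]

theorem polar_unique {ρ ψ σ χ : ℝ} (hρ : 0 < ρ) (hσ : 0 < σ) (h : polar ρ ψ = polar σ χ)
    (hlt : |ψ - χ| < 2 * Real.pi) : ψ = χ := by
  have hn := congrArg norm h
  rw [norm_polar hρ.le, norm_polar hσ.le] at hn
  subst hn
  have h1 : Complex.exp (ψ * Complex.I) = Complex.exp (χ * Complex.I) :=
    mul_left_cancel₀ (by exact_mod_cast hρ.ne') h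
  obtain ⟨m, hm⟩ := Complex.exp_eq_exp_iff_exists_int.1 h1
  have h2 : ψ = χ + m * (2 * Real.pi) := by
    have : ((ψ : ℝ) : ℂ) * Complex.I = ((χ + m * (2 * Real.pi) : ℝ) : ℂ) * Complex.I := by
      rw [hm]; push_cast; ring
    exact_mod_cast mul_right_cancel₀ Complex.I_ne_zero this
  have hpi := Real.two_pi_pos
  have h3 : ψ - χ = m * (2 * Real.pi) := by linarith
  rw [h3, abs_mul, abs_of_pos hpi] at hlt
  have h4 : |(m : ℝ)| < 1 := by
    by_contra hge
    push Not at hge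
    nlinarith
  have h5 : m = 0 := by
    rw [← Int.abs_lt_one_iff]
    exact_mod_cast h4
  rw [h2, h5]; simp

/-- The points other than `0` whose direction is in an interval of length `φ`. -/
def sector (lo φ : ℝ) : Set ℂ := {z | ∃ ρ ψ : ℝ, 0 < ρ ∧ lo ≤ ψ ∧ ψ ≤ lo + φ ∧ z = polar ρ ψ}

theorem zero_notMem_sector (lo φ : ℝ) : (0 : ℂ) ∉ sector lo φ := by
  rintro ⟨ρ, ψ, h, -, -, h0⟩
  have := congrArg norm h0
  rw [norm_polar h.le, norm_zero] at this
  exact h.ne this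

theorem disjoint_sector {lo lo' φ : ℝ} (h1 : lo + φ < lo') (h2 : lo' + φ < lo + 2 * Real.pi) :
    Disjoint (sector lo φ) (sector lo' φ) := by
  refine Set.disjoint_left.2 ?_
  rintro z ⟨ρ, ψ, hρ, a1, a2, rfl⟩ ⟨σ, χ, hσ, b1, b2, he⟩
  have := polar_unique hρ hσ he (by rw [abs_lt]; constructor <;> linarith)
  linarith

/-- The two cross products bound the cone between the extreme rays. Positivity along the bisector
removes the apex and the opposite cone, so for φ < π these are linear conditions and the sector is
convex. -/
theorem mem_sector_iff {lo φ : ℝ} (h0 : 0 < φ) (hpi : φ < Real.pi) (z : ℂ) :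
    z ∈ sector lo φ ↔ 0 < dot (polar 1 (lo + φ / 2)) z ∧
      0 ≤ cross (polar 1 lo) z ∧ cross (polar 1 (lo + φ)) z ≤ 0 := by
  constructor
  · rintro ⟨ρ, ψ, hρ, h1, h2, rfl⟩
    rw [dot_polar, cross_polar, cross_polar, one_mul]
    refine ⟨mul_pos hρ (Real.cos_pos_of_mem_Ioo ⟨by linarith, by linarith⟩),
      mul_nonneg hρ.le (Real.sin_nonneg_of_nonneg_of_le_pi (by linarith) (by linarith)),
      mul_nonpos_of_nonneg_of_nonpos hρ.le
        (Real.sin_nonpos_of_nonpos_of_neg_pi_le (by linarith) (by linarith))⟩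
  · rintro ⟨h1, h2, h3⟩
    set μ := lo + φ / 2 with hμ
    set x := (z / polar 1 μ).arg with hx
    have hp0 : polar 1 μ ≠ 0 := by
      rw [← norm_ne_zero_iff, norm_polar zero_le_one]; norm_num
    have hz0 : z ≠ 0 := by rintro rfl; simp [dot] at h1
    have hz : z = polar ‖z‖ (μ + x) := by
      have := Complex.norm_mul_exp_arg_mul_I (z / polar 1 μ)
      rw [norm_div, norm_polar zero_le_one, div_one, ← hx, eq_div_iff hp0] at this
      rw [← this, polar, polar]
      simp only [norm_mul, Complex.norm_real, norm_norm, Complex.norm_exp_ofReal_mul_I,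
        mul_one, Complex.ofReal_one, one_mul]
      push_cast
      rw [add_mul, Complex.exp_add]; ring
    have hn : 0 < ‖z‖ := norm_pos_iff.2 hz0
    rw [hz] at h1 h2 h3
    rw [dot_polar, one_mul, add_sub_cancel_left] at h1
    rw [cross_polar, one_mul] at h2 h3
    have c1 := pos_of_mul_pos_right h1 hn.le
    have c2 := nonneg_of_mul_nonneg_right h2 hn
    have c3 : Real.sin (μ + x - (lo + φ)) ≤ 0 := by
      by_contra hgt
      push Not at hgt
      have := mul_pos hn hgt
      linarith
    have hxpi := Complex.arg_le_pi (z / polar 1 μ)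
    have hxpi' := Complex.neg_pi_lt_arg (z / polar 1 μ)
    rw [← hx] at hxpi hxpi'
    have d1 : -(Real.pi / 2) < x := by
      by_contra hle
      push Not at hle
      have := Real.cos_nonpos_of_pi_div_two_le_of_le (x := -x) (by linarith) (by linarith)
      rw [Real.cos_neg] at this
      linarith
    have d2 : x < Real.pi / 2 := by
      by_contra hle
      push Not at hle
      have := Real.cos_nonpos_of_pi_div_two_le_of_le (x := x) (by linarith) (by linarith)
      linarith
    refine ⟨‖z‖, μ + x, hn, ?_, ?_, hz⟩
    · by_contra hlt
      push Not at hlt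
      have := Real.sin_neg_of_neg_of_neg_pi_lt (x := μ + x - lo) (by linarith) (by linarith)
      linarith
    · by_contra hlt
      push Not at hlt
      have := Real.sin_pos_of_pos_of_lt_pi (x := μ + x - (lo + φ)) (by linarith) (by linarith)
      linarith

theorem convex_sector {lo φ : ℝ} (h0 : 0 < φ) (hpi : φ < Real.pi) : Convex ℝ (sector lo φ) := by
  intro x hx y hy p q hp hq hpq
  rw [mem_sector_iff h0 hpi] at hx hy ⊢
  obtain ⟨x1, x2, x3⟩ := hx
  obtain ⟨y1, y2, y3⟩ := hy
  simp only [dot_add, dot_smul, cross_add, cross_smul]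
  refine ⟨?_, by positivity, ?_⟩
  · rcases hp.eq_or_lt with rfl | hp
    · have : q = 1 := by linarith
      simpa [this] using y1
    · have := mul_pos hp x1
      have := mul_nonneg hq y1.le
      linarith
  · have := mul_nonneg hp (neg_nonneg.2 x3)
    have := mul_nonneg hq (neg_nonneg.2 y3)
    linarith

theorem segment_zero_subset {lo φ : ℝ} {a z : ℂ} (ha : a ∈ sector lo φ) (hz : z ∈ segment ℝ 0 a) :
    z ∈ sector lo φ ∨ z = 0 := by
  obtain ⟨ρ, ψ, hρ, h1, h2, rfl⟩ := ha
  obtain ⟨s, t, -, ht, -, rfl⟩ := hz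
  rw [smul_zero, zero_add, polar_smul]
  rcases ht.eq_or_lt with rfl | ht
  · right; simp [polar]
  · exact Or.inl ⟨t * ρ, ψ, mul_pos ht hρ, h1, h2, rfl⟩

theorem im_ne_zero_of_mem_sector {lo φ : ℝ} {z : ℂ} (hz : z ∈ sector lo φ)
    (h : (0 < lo ∧ lo + φ < Real.pi) ∨ (Real.pi < lo ∧ lo + φ < 2 * Real.pi)) : z.im ≠ 0 := by
  obtain ⟨ρ, ψ, hρ, h1, h2, rfl⟩ := hz
  rw [polar_im]
  refine mul_ne_zero hρ.ne' ?_
  rcases h with h | h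
  · exact (Real.sin_pos_of_pos_of_lt_pi (by linarith) (by linarith)).ne'
  · rw [← Real.sin_sub_two_pi]
    exact (Real.sin_neg_of_neg_of_neg_pi_lt (by linarith) (by linarith)).ne

/-! ### Eight-petal trees with one petal in each of eight sectors -/

/-- The first direction of the sector of petal `i`. -/
def sectorStart (δ : ℝ) (i : Fin 8) : ℝ := i * (Real.pi / 4) + δ

/-- The width of the sectors. -/
def sectorWidth (δ : ℝ) : ℝ := Real.pi / 4 - 2 * δ

/-- Sector i lies strictly between the directions iπ/4 and (i + 1)π/4, so sectors 0 to 3 are in the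
open upper half-plane and 4 to 7 in the lower one. This keeps petals off the long links. -/
theorem sectorStart_avoids {δ : ℝ} (h0 : 0 < δ) (i : Fin 8) :
    (0 < sectorStart δ i ∧ sectorStart δ i + sectorWidth δ < Real.pi) ∨
      (Real.pi < sectorStart δ i ∧ sectorStart δ i + sectorWidth δ < 2 * Real.pi) := by
  rw [sectorWidth]
  have hpi := Real.pi_pos
  rw [sectorStart]
  rcases Nat.lt_or_ge i.val 4 with h | h
  · left
    have a : (i.val : ℝ) ≤ 3 := by exact_mod_cast Nat.le_of_lt_succ h
    have b : (0 : ℝ) ≤ i.val := Nat.cast_nonneg _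
    constructor <;> nlinarith
  · right
    have a : (i.val : ℝ) ≤ 7 := by exact_mod_cast Nat.le_of_lt_succ i.isLt
    have b : (4 : ℝ) ≤ i.val := by exact_mod_cast h
    constructor <;> nlinarith

theorem disjoint_sectors {δ : ℝ} (h0 : 0 < δ) {i i' : Fin 8} (h : i ≠ i') :
    Disjoint (sector (sectorStart δ i) (sectorWidth δ))
      (sector (sectorStart δ i') (sectorWidth δ)) := by
  have main : ∀ i i' : Fin 8, i < i' → Disjoint (sector (sectorStart δ i) (sectorWidth δ))
      (sector (sectorStart δ i') (sectorWidth δ)) := by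
    intro i i' h
    have hpi := Real.pi_pos
    have a : (i.val : ℝ) + 1 ≤ i'.val := by exact_mod_cast h
    have b : (i'.val : ℝ) ≤ i.val + 7 := by exact_mod_cast (by omega : i'.val ≤ i.val + 7)
    apply disjoint_sector <;> simp only [sectorStart, sectorWidth] <;> nlinarith
  rcases lt_or_gt_of_ne h with h | h
  · exact main _ _ h
  · exact (main _ _ h).symm

/-- A placement of an eight-petal tree around `0`, with each petal in its sector. -/
structure IsFan (l₁ l₂ δ : ℝ) (q : Joint 8 → ℂ) : Prop where
  zero : q .O = 0
  dist_A : ∀ i, dist (q (.A i)) 0 = 1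
  dist_B : ∀ i, dist (q (.B i)) (q (.A i)) = l₁
  dist_C : ∀ i, dist (q (.C i)) (q (.B i)) = l₂
  sector_A : ∀ i, q (.A i) ∈ sector (sectorStart δ i) (sectorWidth δ)
  sector_B : ∀ i, q (.B i) ∈ sector (sectorStart δ i) (sectorWidth δ)
  sector_C : ∀ i, q (.C i) ∈ sector (sectorStart δ i) (sectorWidth δ)
  norm_lt : ∀ x, ‖q x‖ < 3
  inter_AB : ∀ i z, z ∈ segment ℝ (q (.A i)) 0 → z ∈ segment ℝ (q (.B i)) (q (.A i)) → z = q (.A i)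
  inter_BC : ∀ i z, z ∈ segment ℝ (q (.B i)) (q (.A i)) → z ∈ segment ℝ (q (.C i)) (q (.B i)) →
    z = q (.B i)
  inter_AC : ∀ i z, z ∈ segment ℝ (q (.A i)) 0 → z ∉ segment ℝ (q (.C i)) (q (.B i))

/-- Fans placed around the points `0, L, 2L, …` of the real axis. -/
def fanRow {k : ℕ} (L : ℝ) (q : Fin k → Joint 8 → ℂ) (x : Fin k × Joint 8) : ℂ :=
  ((x.1.val * L : ℝ) : ℂ) + q x.1 x.2

theorem mem_segment_add {o x y z : ℂ} :
    z ∈ segment ℝ (o + x) (o + y) ↔ z - o ∈ segment ℝ x y := by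
  rw [← mem_segment_translate ℝ o (x := z - o)]; simp

/-- Long links lie on the real axis, which a petal meets only in its centre. Petals of different
copies lie in disjoint discs of radius 3, and different petals of one copy lie in disjoint sectors
apart from the common centre. Within one petal the intersection conditions of `IsFan` apply. -/
theorem fanRow_isSimple {k : ℕ} {l₁ l₂ δ L : ℝ} {h₁ : 0 < l₁} {h₂ : 0 < l₂} {hL : 0 < L}
    (h0 : 0 < δ) (hw : 0 < sectorWidth δ) (hL6 : 6 ≤ L) {q : Fin k → Joint 8 → ℂ}
    (hq : ∀ j, IsFan l₁ l₂ δ (q j)) : (chain k 8 l₁ l₂ L h₁ h₂ hL).IsSimple (fanRow L q) := by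
  have hpi := Real.pi_pos
  rcases Nat.eq_zero_or_pos k with rfl | hk
  · exact ⟨fun x => x.1.elim0, fun x => x.1.elim0, fun x => x.1.elim0⟩
  have hwpi : sectorWidth δ < Real.pi := by rw [sectorWidth]; linarith
  have hO : ∀ j, fanRow L q (j, .O) = ((j.val * L : ℝ) : ℂ) := fun j => by
    simp [fanRow, (hq j).zero]
  refine (isParentTree_chainGraph hk).isSimple ?_ ?_
  · rintro ⟨j, x⟩ hx
    cases x with
    | O =>
      have hj : j.val ≠ 0 := fun h => hx (by ext <;> simp [h])
      change dist (fanRow L q (j, .O)) (fanRow L q (⟨j.val - 1, _⟩, .O)) = L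
      rw [hO, hO, Complex.isometry_ofReal.dist_eq, Real.dist_eq, ← sub_mul, Nat.cast_sub (by omega)]
      simp [abs_of_pos hL]
    | A i =>
      refine (dist_add_left _ _ _).trans ?_
      change dist (q j (.A i)) (q j .O) = 1
      rw [(hq j).zero]
      exact (hq j).dist_A i
    | B i => exact (dist_add_left _ _ _).trans ((hq j).dist_B i)
    | C i => exact (dist_add_left _ _ _).trans ((hq j).dist_C i)
  -- the links of a petal
  have hpet : ∀ (j : Fin k) (x : Joint 8), x ≠ .O → ∃ i, (x = .A i ∨ x = .B i ∨ x = .C i) ∧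
      ∀ z ∈ segment ℝ (fanRow L q (j, x)) (fanRow L q (chainParent (j, x))),
        ‖z - ((j.val * L : ℝ) : ℂ)‖ < 3 ∧
        (z - ((j.val * L : ℝ) : ℂ) ∈ sector (sectorStart δ i) (sectorWidth δ) ∨
          (x = .A i ∧ z = ((j.val * L : ℝ) : ℂ))) := by
    intro j x hx
    have hball : ∀ x y, ∀ z ∈ segment ℝ (q j x) (q j y), ‖z‖ < 3 := by
      intro x y z hz
      have := (convex_ball (0 : ℂ) 3).segment_subset (x := q j x) (y := q j y)
        (by simpa using (hq j).norm_lt x) (by simpa using (hq j).norm_lt y) hz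
      simpa using this
    cases x with
    | O => exact absurd rfl hx
    | A i =>
      refine ⟨i, Or.inl rfl, fun z hz => ?_⟩
      have hz' := mem_segment_add.1 hz
      refine ⟨hball _ _ _ hz', ?_⟩
      change _ ∈ segment ℝ (q j (.A i)) (q j .O) at hz'
      rw [(hq j).zero, segment_symm] at hz'
      rcases segment_zero_subset ((hq j).sector_A i) hz' with h | h
      · exact Or.inl h
      · exact Or.inr ⟨rfl, sub_eq_zero.1 h⟩
    | B i =>
      refine ⟨i, Or.inr (Or.inl rfl), fun z hz => ?_⟩
      have hz' := mem_segment_add.1 hz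
      exact ⟨hball _ _ _ hz', Or.inl ((convex_sector hw hwpi).segment_subset
        ((hq j).sector_B i) ((hq j).sector_A i) hz')⟩
    | C i =>
      refine ⟨i, Or.inr (Or.inr rfl), fun z hz => ?_⟩
      have hz' := mem_segment_add.1 hz
      exact ⟨hball _ _ _ hz', Or.inl ((convex_sector hw hwpi).segment_subset
        ((hq j).sector_C i) ((hq j).sector_B i) hz')⟩
  -- the links between centres
  have hrow : ∀ j : Fin k, j.val ≠ 0 → ∀ z ∈ segment ℝ (fanRow L q (j, .O))
      (fanRow L q (chainParent (j, .O))), ((j.val : ℝ) - 1) * L ≤ z.re ∧ z.re ≤ j.val * L ∧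
        z.im = 0 := by
    intro j hj z hz
    change z ∈ segment ℝ (fanRow L q (j, .O)) (fanRow L q (⟨j.val - 1, _⟩, .O)) at hz
    rw [hO, hO] at hz
    obtain ⟨s, t, hs, ht, hst, rfl⟩ := hz
    have : ((j.val - 1 : ℕ) : ℝ) = (j.val : ℝ) - 1 := by
      rw [Nat.cast_sub (by omega)]; simp
    simp only [Complex.add_re, Complex.add_im, Complex.real_smul, Complex.re_ofReal_mul,
      Complex.im_ofReal_mul, Complex.ofReal_re, Complex.ofReal_im, this]
    have e : s = 1 - t := by linarith
    subst e
    refine ⟨?_, ?_, by ring⟩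
    · nlinarith
    · nlinarith
  have hsame : ∀ (j : Fin k) (i : Fin 8) (z : ℂ),
      (z ∈ segment ℝ (fanRow L q (j, .A i)) (fanRow L q (chainParent (j, .A i))) →
        z ∈ segment ℝ (fanRow L q (j, .B i)) (fanRow L q (chainParent (j, .B i))) →
          z = fanRow L q (j, .A i)) ∧
      (z ∈ segment ℝ (fanRow L q (j, .B i)) (fanRow L q (chainParent (j, .B i))) →
        z ∈ segment ℝ (fanRow L q (j, .C i)) (fanRow L q (chainParent (j, .C i))) →
          z = fanRow L q (j, .B i)) ∧
      (z ∈ segment ℝ (fanRow L q (j, .A i)) (fanRow L q (chainParent (j, .A i))) →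
        z ∉ segment ℝ (fanRow L q (j, .C i)) (fanRow L q (chainParent (j, .C i)))) := by
    intro j i z
    refine ⟨fun a b => ?_, fun a b => ?_, fun a b => ?_⟩
    · have a := mem_segment_add.1 a
      have b := mem_segment_add.1 b
      change _ ∈ segment ℝ (q j (.A i)) (q j .O) at a
      rw [(hq j).zero] at a
      have := (hq j).inter_AB i _ a b
      exact (sub_eq_iff_eq_add'.1 this)
    · have a := mem_segment_add.1 a
      have b := mem_segment_add.1 b
      exact (sub_eq_iff_eq_add'.1 ((hq j).inter_BC i _ a b))
    · have a := mem_segment_add.1 a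
      have b := mem_segment_add.1 b
      change _ ∈ segment ℝ (q j (.A i)) (q j .O) at a
      rw [(hq j).zero] at a
      exact (hq j).inter_AC i _ a b
  -- a link between centres and a link of a petal
  have hmix : ∀ (j j' : Fin k) (x : Joint 8), j.val ≠ 0 → x ≠ .O →
      ∀ z ∈ segment ℝ (fanRow L q (j, .O)) (fanRow L q (chainParent (j, .O))),
      z ∈ segment ℝ (fanRow L q (j', x)) (fanRow L q (chainParent (j', x))) →
        ∃ v, (v = (j, .O) ∨ v = chainParent (j, .O)) ∧
          (v = (j', x) ∨ v = chainParent (j', x)) ∧ z = fanRow L q v := by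
    intro j j' x hj hx z hz hz'
    obtain ⟨r1, r2, r3⟩ := hrow j hj z hz
    obtain ⟨i, -, hi⟩ := hpet j' x hx
    obtain ⟨-, h | ⟨rfl, h⟩⟩ := hi z hz'
    · refine absurd ?_ (im_ne_zero_of_mem_sector h (sectorStart_avoids h0 i))
      rw [Complex.sub_im, r3, Complex.ofReal_im, sub_zero]
    · refine ⟨(j', .O), ?_, Or.inr rfl, by rw [h, hO]⟩
      rw [h, Complex.ofReal_re] at r1 r2
      have a : (j.val : ℝ) - 1 ≤ j'.val := le_of_mul_le_mul_right r1 hL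
      have b : (j'.val : ℝ) ≤ j.val := le_of_mul_le_mul_right r2 hL
      have a' : j.val ≤ j'.val + 1 := by
        have : (j.val : ℝ) ≤ j'.val + 1 := by linarith
        exact_mod_cast this
      have b' : j'.val ≤ j.val := by exact_mod_cast b
      rcases Nat.lt_or_ge j'.val j.val with h | h
      · right
        simp only [chainParent, Prod.mk.injEq, and_true]
        ext; simp only; omega
      · left
        simp only [Prod.mk.injEq, and_true]
        ext; omega
  rintro ⟨j, x⟩ ⟨j', y⟩ hx hy hne z hz hz'
  by_cases hxO : x = .O
  · subst hxO
    have hj : j.val ≠ 0 := fun h => hx (by ext <;> simp [h])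
    by_cases hyO : y = .O
    · subst hyO
      have hj' : j'.val ≠ 0 := fun h => hy (by ext <;> simp [h])
      have main : ∀ j j' : Fin k, j.val ≠ 0 → j'.val ≠ 0 → j < j' → ∀ z,
        z ∈ segment ℝ (fanRow L q (j, .O)) (fanRow L q (chainParent (j, .O))) →
        z ∈ segment ℝ (fanRow L q (j', .O)) (fanRow L q (chainParent (j', .O))) →
          (j, .O) = chainParent (j', Joint.O (n := 8)) ∧ z = fanRow L q (j, .O) := by
        intro j j' hj hj' hlt z hz hz'
        obtain ⟨-, r2, r3⟩ := hrow j hj z hz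
        obtain ⟨s1, -, -⟩ := hrow j' hj' z hz'
        have a : (j'.val : ℝ) - 1 ≤ j.val := le_of_mul_le_mul_right (s1.trans r2) hL
        have a' : j'.val ≤ j.val + 1 := by
          have : (j'.val : ℝ) ≤ j.val + 1 := by linarith
          exact_mod_cast this
        have e : j'.val = j.val + 1 := by have : j.val < j'.val := hlt; omega
        refine ⟨?_, ?_⟩
        · simp only [chainParent, Prod.mk.injEq, and_true]
          ext; simp only; omega
        · rw [hO]
          apply Complex.ext
          · rw [Complex.ofReal_re]
            rw [e] at s1
            push_cast at s1
            linarith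
          · rw [r3, Complex.ofReal_im]
      have hjj : j ≠ j' := fun h => hne (by rw [h])
      rcases lt_or_gt_of_ne hjj with h | h
      · obtain ⟨a, b⟩ := main j j' hj hj' h z hz hz'
        exact ⟨(j, .O), Or.inl rfl, Or.inr a, b⟩
      · obtain ⟨a, b⟩ := main j' j hj' hj h z hz' hz
        exact ⟨(j', .O), Or.inr a, Or.inl rfl, b⟩
    · exact hmix j j' y hj hyO z hz hz'
  · by_cases hyO : y = .O
    · subst hyO
      have hj' : j'.val ≠ 0 := fun h => hy (by ext <;> simp [h])
      obtain ⟨v, a, b, c⟩ := hmix j' j x hj' hxO z hz' hz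
      exact ⟨v, b, a, c⟩
    · obtain ⟨i, hi, hp⟩ := hpet j x hxO
      obtain ⟨i', hi', hp'⟩ := hpet j' y hyO
      obtain ⟨n1, m1⟩ := hp z hz
      obtain ⟨n2, m2⟩ := hp' z hz'
      have hjj : j = j' := by
        by_contra hjj
        -- A common point is at distance less than 3 from both centres, whereas distinct centres are
        -- at least L ≥ 6 apart.
        have h3 : |(j.val : ℝ) * L - j'.val * L| < 6 := by
          rw [← Real.norm_eq_abs, ← Complex.norm_real]
          have e : (((j.val : ℝ) * L - j'.val * L : ℝ) : ℂ) =
              (z - ((j'.val * L : ℝ) : ℂ)) - (z - ((j.val * L : ℝ) : ℂ)) := by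
            push_cast; ring
          rw [e]
          have := norm_sub_le (z - ((j'.val * L : ℝ) : ℂ)) (z - ((j.val * L : ℝ) : ℂ))
          linarith
        rw [← sub_mul, abs_mul, abs_of_pos hL] at h3
        have h4 : (1 : ℝ) ≤ |(j.val : ℝ) - j'.val| := by
          have : (1 : ℤ) ≤ |(j.val : ℤ) - j'.val| := by
            apply Int.one_le_abs
            intro h
            apply hjj
            ext; omega
          exact_mod_cast this
        nlinarith
      subst hjj
      by_cases hii : i = i'
      · subst hii
        rcases hi with rfl | rfl | rfl <;> rcases hi' with rfl | rfl | rfl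
        · exact absurd rfl hne
        · exact ⟨(j, .A i), Or.inl rfl, Or.inr rfl, (hsame j i z).1 hz hz'⟩
        · exact absurd hz' ((hsame j i z).2.2 hz)
        · exact ⟨(j, .A i), Or.inr rfl, Or.inl rfl, (hsame j i z).1 hz' hz⟩
        · exact absurd rfl hne
        · exact ⟨(j, .B i), Or.inl rfl, Or.inr rfl, (hsame j i z).2.1 hz hz'⟩
        · exact absurd hz ((hsame j i z).2.2 hz')
        · exact ⟨(j, .B i), Or.inr rfl, Or.inl rfl, (hsame j i z).2.1 hz' hz⟩
        · exact absurd rfl hne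
      · rcases m1 with m1 | ⟨rfl, m1⟩ <;> rcases m2 with m2 | ⟨rfl, m2⟩
        · exact absurd m2 (Set.disjoint_left.1 (disjoint_sectors h0 hii) m1)
        · rw [m2, sub_self] at m1
          exact absurd m1 (zero_notMem_sector _ _)
        · rw [m1, sub_self] at m2
          exact absurd m2 (zero_notMem_sector _ _)
        · exact ⟨(j, .O), Or.inr rfl, Or.inr rfl, by rw [m1, hO]⟩

/-! ### Cyclic orders -/

theorem ccwAngle_self {O X : ℂ} (h : X ≠ O) : ccwAngle O X X = 0 :=
  ccwAngle_eq (θ := 0) (r := 1) ⟨le_rfl, Real.two_pi_pos⟩ one_pos h (by simp)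

/-- If two links at v had the same direction, the shorter one would lie on the longer one. -/
theorem Linkage.IsSimple.ccwAngle_pos {V : Type*} {T : Linkage V} {p : V → ℂ} (hp : T.IsSimple p)
    {v a b : V} (ha : T.graph.Adj v a) (hb : T.graph.Adj v b) (hab : a ≠ b) :
    0 < ccwAngle (p v) (p a) (p b) := by
  refine lt_of_le_of_ne (ccwAngle_mem _ _ _).1 fun h0 => ?_
  have hne : ∀ c, T.graph.Adj v c → p c ≠ p v := fun c hc he => by
    have h1 := hp.dist_eq v c hc
    rw [he, dist_self] at h1
    exact (T.len_pos v c hc).ne h1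
  have main : ∀ a b, T.graph.Adj v a → T.graph.Adj v b → a ≠ b → ∀ t : ℝ, 0 ≤ t → t ≤ 1 →
      p b - p v ≠ t • (p a - p v) := by
    intro a b ha hb hab t h0 h1 he
    have hm := hp.incident v a b ha hb hab
    have : p b ∈ ({p v} : Set ℂ) := by
      rw [← hm]
      refine ⟨?_, right_mem_segment ℝ _ _⟩
      rw [← segment_sub_mem, he]
      exact smul_mem_segment h0 h1 _
    exact hne b hb this
  have h := exp_ccwAngle (p v) (p a) (p b)
  rw [← h0] at h
  have ha0 : p a - p v ≠ 0 := sub_ne_zero.2 (hne a ha)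
  set ρ := ‖(p b - p v) / (p a - p v)‖
  simp only [Complex.ofReal_zero, zero_mul, Complex.exp_zero, mul_one] at h
  rw [eq_div_iff ha0] at h
  have hρ : 0 ≤ ρ := norm_nonneg _
  rcases le_total ρ 1 with h1 | h1
  · exact main a b ha hb hab ρ hρ h1 (by rw [← h, Complex.real_smul])
  · refine main b a hb ha hab.symm ρ⁻¹ (by positivity) (inv_le_one_of_one_le₀ h1) ?_
    have h2 : (ρ : ℂ) ≠ 0 := by
      have : ρ ≠ 0 := by linarith
      exact_mod_cast this
    rw [← h, Complex.real_smul, Complex.ofReal_inv, inv_mul_cancel_left₀ h2]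

/-- The cyclic order around a joint of degree at most two. -/
theorem Linkage.IsSimple.ccwAngle_lt_iff {V : Type*} {T : Linkage V} {p : V → ℂ}
    (hp : T.IsSimple p) {v x y : V} (hN : ∀ b, T.graph.Adj v b → b = x ∨ b = y) {a b c : V}
    (ha : T.graph.Adj v a) (hb : T.graph.Adj v b) (hc : T.graph.Adj v c) :
    ccwAngle (p v) (p a) (p b) < ccwAngle (p v) (p a) (p c) ↔ a = b ∧ a ≠ c := by
  have hself : ccwAngle (p v) (p a) (p a) = 0 := by
    refine ccwAngle_self fun he => ?_
    have h1 := hp.dist_eq v a ha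
    rw [he, dist_self] at h1
    exact (T.len_pos v a ha).ne h1
  constructor
  · intro h
    have hbc : b ≠ c := by rintro rfl; exact lt_irrefl _ h
    have hac : a ≠ c := by
      rintro rfl
      rw [hself] at h
      exact absurd (ccwAngle_mem (p v) (p a) (p b)).1 (not_le.2 h)
    refine ⟨?_, hac⟩
    rcases hN a ha with h1 | h1 <;> rcases hN b hb with h2 | h2 <;> rcases hN c hc with h3 | h3 <;>
      simp_all
  · rintro ⟨rfl, hac⟩
    rw [hself]
    exact hp.ccwAngle_pos ha hc hac

theorem ccwAngle_polar {O X Y : ℂ} {ρ x σ y : ℝ} (hρ : 0 < ρ) (hσ : 0 < σ)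
    (hx : x ∈ Set.Ico 0 (2 * Real.pi)) (hy : y ∈ Set.Ico 0 (2 * Real.pi))
    (hX : X - O = polar ρ x) (hY : Y - O = polar σ y) :
    ccwAngle O X Y = if x ≤ y then y - x else y - x + 2 * Real.pi := by
  have hX0 : X ≠ O := by
    rw [← sub_ne_zero, hX, ← norm_ne_zero_iff, norm_polar hρ.le]
    exact hρ.ne'
  have h1 : ∀ m : ℤ, Y - O = ((σ / ρ : ℝ) : ℂ) *
      Complex.exp (((y - x + m * (2 * Real.pi) : ℝ) : ℂ) * Complex.I) * (X - O) := by
    intro m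
    change Y - O = polar (σ / ρ) (y - x + m * (2 * Real.pi)) * (X - O)
    rw [polar_add_two_pi, hX, hY, polar, polar, polar]
    have : (ρ : ℂ) ≠ 0 := by exact_mod_cast hρ.ne'
    push_cast
    rw [sub_mul, Complex.exp_sub]
    field_simp
  split_ifs with h
  · exact ccwAngle_eq ⟨by linarith, by linarith [hx.1, hy.2]⟩ (div_pos hσ hρ) hX0
      (by simpa using h1 0)
  · exact ccwAngle_eq ⟨by linarith [hx.2, hy.1], by linarith [hx.1, hy.2]⟩ (div_pos hσ hρ) hX0
      (by simpa using h1 1)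

/-- If the directions of the links at `v` are ordered as the values of `τ`, then so is their
cyclic order. -/
theorem ccwAngle_lt_iff_of_order {V : Type*} {p : V → ℂ} {v a b c : V} {τ : V → ℕ} {ρ x : V → ℝ}
    {N : V → Prop} (h : ∀ u, N u → 0 < ρ u ∧ x u ∈ Set.Ico 0 (2 * Real.pi) ∧
      p u - p v = polar (ρ u) (x u))
    (hτ : ∀ u w, N u → N w → (x u < x w ↔ τ u < τ w)) (ha : N a) (hb : N b) (hc : N c) :
    ccwAngle (p v) (p a) (p b) < ccwAngle (p v) (p a) (p c) ↔
      (τ a ≤ τ b ∧ τ a ≤ τ c ∧ τ b < τ c) ∨ (τ a ≤ τ b ∧ τ c < τ a) ∨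
        (τ b < τ a ∧ τ c < τ a ∧ τ b < τ c) := by
  obtain ⟨a1, a2, a3⟩ := h a ha
  obtain ⟨b1, b2, b3⟩ := h b hb
  obtain ⟨c1, c2, c3⟩ := h c hc
  have hle : ∀ u w, N u → N w → (τ u ≤ τ w ↔ x u ≤ x w) := fun u w hu hw => by
    rw [← not_lt, ← not_lt, hτ w u hw hu]
  rw [ccwAngle_polar a1 b1 a2 b2 a3 b3, ccwAngle_polar a1 c1 a2 c2 a3 c3,
    ← hτ _ _ hb ha, ← hτ _ _ hc ha, ← hτ _ _ hb hc, hle _ _ ha hb, hle _ _ ha hc]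
  have := a2.1
  have := a2.2
  have := b2.1
  have := b2.2
  have := c2.1
  have := c2.2
  clear hle hτ h a3 b3 c3
  split_ifs <;> grind

/-- The position of `b` in the order of the links at the centre of copy `j`. -/
def linkRank {k : ℕ} (j : Fin k) (b : Fin k × Joint 8) : ℕ :=
  match b.2 with
  | .O => if b.1.val < j.val then 8 else 0
  | .A i => 2 * i + 1
  | _ => 0

/-- Ranks count directions in units of π/8: the next centre has direction 0, the previous one has
direction π (rank 8), and the odd rank 2i + 1 is the middle of the range of `A i`. Only even ranks
determine the direction exactly. -/
theorem fanRow_direction {k : ℕ} {l₁ l₂ δ L : ℝ} (hL : 0 < L) (h0 : 0 < δ)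
    {q : Fin k → Joint 8 → ℂ} (hq : ∀ j, IsFan l₁ l₂ δ (q j)) (j : Fin k) (b : Fin k × Joint 8)
    (hb : (chainGraph k 8).Adj (j, .O) b) :
    ∃ ρ x : ℝ, (0 < ρ ∧ x ∈ Set.Ico 0 (2 * Real.pi) ∧
      fanRow L q b - fanRow L q (j, .O) = polar ρ x) ∧
      (linkRank j b - 1 : ℝ) * (Real.pi / 8) < x ∧ x < (linkRank j b + 1 : ℝ) * (Real.pi / 8) ∧
      (Even (linkRank j b) → x = linkRank j b * (Real.pi / 8)) := by
  have hpi := Real.pi_pos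
  obtain ⟨j', b⟩ := b
  rcases hb with ⟨h1, h2⟩ | ⟨-, h2, h3⟩
  · obtain rfl : j = j' := h1
    cases b with
    | A i =>
      obtain ⟨ρ, ψ, hρ, a1, a2, he⟩ := (hq j).sector_A i
      have hi : (i.val : ℝ) ≤ 7 := by exact_mod_cast Nat.le_of_lt_succ i.isLt
      have hi0 : (0 : ℝ) ≤ i.val := Nat.cast_nonneg _
      have hi1 : (0 : ℝ) ≤ i.val * (Real.pi / 4) := by positivity
      have hi2 : i.val * (Real.pi / 4) ≤ 7 * (Real.pi / 4) := by gcongr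
      have e : (i.val : ℝ) * (Real.pi / 4) = 2 * (i.val * (Real.pi / 8)) := by ring
      rw [sectorStart] at a1 a2
      rw [sectorWidth] at a2
      refine ⟨ρ, ψ, ⟨hρ, ⟨by linarith, by linarith⟩, ?_⟩, ?_, ?_, ?_⟩
      · simp only [fanRow, (hq j).zero, ← he]; ring
      · simp only [linkRank]; push_cast; linarith
      · simp only [linkRank]; push_cast; linarith
      · simp only [linkRank]
        intro h
        exact absurd h (Nat.not_even_two_mul_add_one _)
    | O => exact h2.elim
    | B => exact h2.elim
    | C => exact h2.elim
  · obtain rfl : b = .O := h2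
    simp only at h3
    have hd : fanRow L q (j', .O) - fanRow L q (j, .O) =
        ((((j'.val : ℝ) - j.val) * L : ℝ) : ℂ) := by
      simp only [fanRow, (hq j).zero, (hq j').zero]; push_cast; ring
    rw [hd]
    rcases h3 with h3 | h3
    · have hlt : ¬ j'.val < j.val := by omega
      refine ⟨L, 0, ⟨hL, ⟨le_rfl, by linarith⟩, ?_⟩, ?_, ?_, ?_⟩
      · rw [← h3]; simp [polar]
      all_goals simp only [linkRank, hlt, if_false]
      · push_cast; linarith
      · push_cast; linarith
      · simp
    · have hlt : j'.val < j.val := by omega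
      refine ⟨L, Real.pi, ⟨hL, ⟨by linarith, by linarith⟩, ?_⟩, ?_, ?_, ?_⟩
      · rw [← h3]; simp [polar]
      all_goals simp only [linkRank, hlt, if_true]
      · push_cast; linarith
      · push_cast; linarith
      · intro _; push_cast; ring

/-- Adjacency to the centre is needed: joints B and C, and all centres on the same side, share a
rank. -/
theorem linkRank_injOn {k : ℕ} (j : Fin k) {b c : Fin k × Joint 8}
    (hb : (chainGraph k 8).Adj (j, .O) b) (hc : (chainGraph k 8).Adj (j, .O) c)
    (h : linkRank j b = linkRank j c) : b = c := by
  obtain ⟨j', b⟩ := b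
  obtain ⟨j'', c⟩ := c
  cases b <;> cases c <;> simp [chainGraph, petalAdj, linkRank, Fin.ext_iff] at * <;>
    (try split_ifs at h) <;> omega

/-- The right-hand side does not mention the fans, so any two rows have the same cyclic order at
their centres. The directions are ordered as the ranks: two odd ranks differ by at least 2, so their
ranges are disjoint, and an even rank is an exact direction outside the ranges of the others. -/
theorem fanRow_ccwAngle_lt_iff {k : ℕ} {l₁ l₂ δ L : ℝ} (hL : 0 < L) (h0 : 0 < δ)
    {q : Fin k → Joint 8 → ℂ} (hq : ∀ j, IsFan l₁ l₂ δ (q j)) (j : Fin k) {a b c : Fin k × Joint 8}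
    (ha : (chainGraph k 8).Adj (j, .O) a) (hb : (chainGraph k 8).Adj (j, .O) b)
    (hc : (chainGraph k 8).Adj (j, .O) c) :
    ccwAngle (fanRow L q (j, .O)) (fanRow L q a) (fanRow L q b) <
        ccwAngle (fanRow L q (j, .O)) (fanRow L q a) (fanRow L q c) ↔
      (linkRank j a ≤ linkRank j b ∧ linkRank j a ≤ linkRank j c ∧ linkRank j b < linkRank j c) ∨
        (linkRank j a ≤ linkRank j b ∧ linkRank j c < linkRank j a) ∨
          (linkRank j b < linkRank j a ∧ linkRank j c < linkRank j a ∧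
            linkRank j b < linkRank j c) := by
  have hpi := Real.pi_pos
  choose! ρ x h1 h2 h3 h4 using fanRow_direction hL h0 hq j
  have hmono : ∀ u w, (chainGraph k 8).Adj (j, .O) u → (chainGraph k 8).Adj (j, .O) w →
      linkRank j u < linkRank j w → x u < x w := by
    intro u w hu hw hlt
    rcases Nat.even_or_odd (linkRank j u) with e | e
    · rw [h4 u hu e]
      refine lt_of_le_of_lt ?_ (h2 w hw)
      have : (linkRank j u : ℝ) + 1 ≤ linkRank j w := by exact_mod_cast hlt
      gcongr; linarith
    · rcases Nat.even_or_odd (linkRank j w) with e' | e'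
      · rw [h4 w hw e']
        refine (h3 u hu).trans_le ?_
        have : (linkRank j u : ℝ) + 1 ≤ linkRank j w := by exact_mod_cast hlt
        gcongr
      · refine (h3 u hu).trans_le (le_trans ?_ (h2 w hw).le)
        have : linkRank j u + 2 ≤ linkRank j w := by
          obtain ⟨m, hm⟩ := e
          obtain ⟨m', hm'⟩ := e'
          omega
        have : (linkRank j u : ℝ) + 2 ≤ linkRank j w := by exact_mod_cast this
        gcongr; linarith
  have hiff : ∀ u w, (chainGraph k 8).Adj (j, .O) u → (chainGraph k 8).Adj (j, .O) w →
      (x u < x w ↔ linkRank j u < linkRank j w) := by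
    intro u w hu hw
    refine ⟨fun h => ?_, hmono u w hu hw⟩
    by_contra hge
    rcases (not_lt.1 hge).lt_or_eq with h5 | h5
    · exact lt_asymm h (hmono w u hw hu h5)
    · rw [linkRank_injOn j hw hu h5] at h
      exact lt_irrefl _ h
  exact ccwAngle_lt_iff_of_order (p := fanRow L q) (v := (j, .O)) h1 hiff ha hb hc

theorem eq_or_eq_of_adj_A {k : ℕ} {j : Fin k} {i : Fin 8} (b : Fin k × Joint 8)
    (hb : (chainGraph k 8).Adj (j, .A i) b) : b = (j, .O) ∨ b = (j, .B i) := by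
  obtain ⟨j', b⟩ := b
  cases b <;> simp [chainGraph, petalAdj] at hb ⊢
  · exact hb.symm
  · exact ⟨hb.1.symm, hb.2.symm⟩

theorem eq_or_eq_of_adj_B {k : ℕ} {j : Fin k} {i : Fin 8} (b : Fin k × Joint 8)
    (hb : (chainGraph k 8).Adj (j, .B i) b) : b = (j, .A i) ∨ b = (j, .C i) := by
  obtain ⟨j', b⟩ := b
  cases b <;> simp [chainGraph, petalAdj] at hb ⊢
  · exact ⟨hb.1.symm, hb.2.symm⟩
  · exact ⟨hb.1.symm, hb.2.symm⟩

theorem eq_of_adj_C {k : ℕ} {j : Fin k} {i : Fin 8} (b : Fin k × Joint 8)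
    (hb : (chainGraph k 8).Adj (j, .C i) b) : b = (j, .B i) := by
  obtain ⟨j', b⟩ := b
  cases b <;> simp [chainGraph, petalAdj] at hb ⊢
  exact ⟨hb.1.symm, hb.2.symm⟩

theorem fanRow_sameRotation {k : ℕ} {l₁ l₂ δ L : ℝ} {h₁ : 0 < l₁} {h₂ : 0 < l₂} {hL : 0 < L}
    (h0 : 0 < δ) {q q' : Fin k → Joint 8 → ℂ}
    (hq : ∀ j, IsFan l₁ l₂ δ (q j)) (hq' : ∀ j, IsFan l₁ l₂ δ (q' j))
    (hs : (chain k 8 l₁ l₂ L h₁ h₂ hL).IsSimple (fanRow L q))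
    (hs' : (chain k 8 l₁ l₂ L h₁ h₂ hL).IsSimple (fanRow L q')) :
    (chain k 8 l₁ l₂ L h₁ h₂ hL).SameRotation (fanRow L q) (fanRow L q') := by
  rintro ⟨j, v⟩ a b c ha hb hc
  have two : ∀ x y, (∀ b, (chainGraph k 8).Adj (j, v) b → b = x ∨ b = y) →
      (ccwAngle (fanRow L q (j, v)) (fanRow L q a) (fanRow L q b) <
        ccwAngle (fanRow L q (j, v)) (fanRow L q a) (fanRow L q c) ↔
      ccwAngle (fanRow L q' (j, v)) (fanRow L q' a) (fanRow L q' b) <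
        ccwAngle (fanRow L q' (j, v)) (fanRow L q' a) (fanRow L q' c)) := fun x y h => by
    rw [hs.ccwAngle_lt_iff h ha hb hc, hs'.ccwAngle_lt_iff h ha hb hc]
  cases v with
  | O =>
    rw [fanRow_ccwAngle_lt_iff hL h0 hq j ha hb hc, fanRow_ccwAngle_lt_iff hL h0 hq' j ha hb hc]
  | A i => exact two _ _ eq_or_eq_of_adj_A
  | B i => exact two _ _ eq_or_eq_of_adj_B
  | C i => exact two (j, .B i) (j, .B i) fun b hb => Or.inl (eq_of_adj_C b hb)

/-! ### Closed and open fans -/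

theorem mem_segment_polar {a b ψ : ℝ} (hab : b ≤ a) {z : ℂ}
    (hz : z ∈ segment ℝ (polar a ψ) (polar b ψ)) : ∃ x, b ≤ x ∧ x ≤ a ∧ z = polar x ψ := by
  obtain ⟨s, t, hs, ht, hst, rfl⟩ := hz
  refine ⟨s * a + t * b, ?_, ?_, by rw [polar_smul, polar_smul, polar_add]⟩
  · have h1 : s * b ≤ s * a := by gcongr
    have h2 : s * b + t * b = b := by rw [← add_mul, hst, one_mul]
    linarith
  · have h1 : t * b ≤ t * a := by gcongr
    have h2 : s * a + t * a = a := by rw [← add_mul, hst, one_mul]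
    linarith

theorem polar_zero (ψ : ℝ) : polar 0 ψ = 0 := by simp [polar]

theorem dist_polar (a b ψ : ℝ) : dist (polar a ψ) (polar b ψ) = |a - b| := by
  rw [dist_eq_norm, polar_sub, polar, norm_mul, Complex.norm_exp_ofReal_mul_I, mul_one,
    Complex.norm_real, Real.norm_eq_abs]

theorem polar_left_injective {x y ψ : ℝ} (hx : 0 ≤ x) (hy : 0 ≤ y) (h : polar x ψ = polar y ψ) :
    x = y := by
  have := congrArg norm h
  rwa [norm_polar hx, norm_polar hy] at this

theorem sectorStart_add_mem {δ : ℝ} {ρ : ℝ} (h : 0 < ρ) (hw : 0 < sectorWidth δ) (i : Fin 8) :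
    polar ρ (sectorStart δ i) ∈ sector (sectorStart δ i) (sectorWidth δ) ∧
      polar ρ (sectorStart δ i + sectorWidth δ) ∈ sector (sectorStart δ i) (sectorWidth δ) :=
  ⟨⟨ρ, _, h, le_rfl, by linarith, rfl⟩, ⟨ρ, _, h, by linarith, le_rfl, rfl⟩⟩

/-- A closed petal tree: `C` is on the segment `OB`, and `B` is close to the last petal. -/
def closedFan (l₂ δ r : ℝ) : Joint 8 → ℂ
  | .O => 0
  | .A i => polar 1 (sectorStart δ i + sectorWidth δ)
  | .B i => polar r (sectorStart δ i)
  | .C i => polar (r - l₂) (sectorStart δ i)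

/-- The direction of petal `i` in an open petal tree. -/
def openDirection (δ : ℝ) (i : Fin 8) : ℝ :=
  -- Petal 0 is at the end of its sector and petal 1 at the start of the next one, at directions π/4
  -- − δ and π/4 + δ.
  if i = 1 then sectorStart δ i else sectorStart δ i + sectorWidth δ

/-- An open petal tree: the petals are straight, and two of them form a small angle. -/
def openFan (l₁ l₂ δ : ℝ) : Joint 8 → ℂ
  | .O => 0
  | .A i => polar 1 (openDirection δ i)
  | .B i => polar (1 + l₁) (openDirection δ i)
  | .C i => polar (1 + l₁ + l₂) (openDirection δ i)

/-- The links OA and BC lie on the two bounding rays of the sector, and AB joins these rays. A cross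
product with one ray therefore isolates the only possible common point; the hypothesis on r is the
law of cosines for AB = l₁. -/
theorem closedFan_isFan {l₁ l₂ δ r : ℝ} (h₁ : 0 < l₁) (h₂ : 0 < l₂) (h0 : 0 < δ)
    (hw : 0 < sectorWidth δ) (hr : l₂ < r) (hr1 : r < 1)
    (hr2 : r ^ 2 - 2 * r * Real.cos (sectorWidth δ) + 1 = l₁ ^ 2) :
    IsFan l₁ l₂ δ (closedFan l₂ δ r) := by
  have hpi := Real.pi_pos
  have hsin : 0 < Real.sin (sectorWidth δ) :=
    Real.sin_pos_of_pos_of_lt_pi hw (by rw [sectorWidth]; linarith)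
  have hr0 : 0 < r := h₂.trans hr
  have hc : ∀ (i : Fin 8) (ρ σ : ℝ), cross (polar ρ (sectorStart δ i))
      (polar σ (sectorStart δ i + sectorWidth δ)) = ρ * σ * Real.sin (sectorWidth δ) := by
    intro i ρ σ
    rw [cross_polar, add_sub_cancel_left]
  refine ⟨rfl, ?_, ?_, ?_, ?_, ?_, ?_, ?_, ?_, ?_, ?_⟩
  · intro i
    simp only [closedFan, dist_zero_right]
    exact norm_polar zero_le_one _
  · intro i
    have : dist (polar r (sectorStart δ i)) (polar 1 (sectorStart δ i + sectorWidth δ)) ^ 2 =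
        l₁ ^ 2 := by
      rw [dist_eq_norm, ← dot_self, dot_self_sub, dot_polar, dot_polar, dot_polar, ← hr2,
        add_sub_cancel_left, sub_self, sub_self, Real.cos_zero]
      ring
    exact (sq_eq_sq₀ dist_nonneg h₁.le).1 this
  · intro i
    simp only [closedFan]
    rw [dist_polar, abs_sub_comm, sub_sub_cancel, abs_of_pos h₂]
  · exact fun i => (sectorStart_add_mem one_pos hw i).2
  · exact fun i => (sectorStart_add_mem hr0 hw i).1
  · exact fun i => (sectorStart_add_mem (by linarith) hw i).1
  · rintro (_ | i | i | i) <;> simp only [closedFan]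
    · simp
    · rw [norm_polar zero_le_one]; norm_num
    · rw [norm_polar hr0.le]; linarith
    · rw [norm_polar (by linarith)]; linarith
  · rintro i z hz ⟨s, t, -, -, hst, rfl⟩
    simp only [closedFan] at hz ⊢
    rw [← polar_zero (sectorStart δ i + sectorWidth δ)] at hz
    obtain ⟨x, -, -, hx⟩ := mem_segment_polar zero_le_one hz
    have h := congrArg (cross (polar 1 (sectorStart δ i + sectorWidth δ))) hx
    rw [cross_add, cross_smul, cross_smul, cross_self, cross_polar _ _ x, sub_self, Real.sin_zero,
      cross_swap, hc] at h
    have hs : s = 0 := by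
      have : s * (r * 1 * Real.sin (sectorWidth δ)) = 0 := by linarith
      rcases mul_eq_zero.1 this with h | h
      · exact h
      · exact absurd h (by positivity)
    have ht : t = 1 := by linarith
    simp [hs, ht]
  · rintro i z ⟨s, t, -, -, hst, rfl⟩ hz
    simp only [closedFan] at hz ⊢
    obtain ⟨x, -, -, hx⟩ := mem_segment_polar (a := r) (b := r - l₂) (by linarith)
      (by rwa [segment_symm] at hz)
    have h := congrArg (cross (polar r (sectorStart δ i))) hx
    rw [cross_add, cross_smul, cross_smul, cross_self, cross_polar _ _ x, sub_self, Real.sin_zero,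
      hc] at h
    have ht : t = 0 := by
      have : t * (r * 1 * Real.sin (sectorWidth δ)) = 0 := by linarith
      rcases mul_eq_zero.1 this with h | h
      · exact h
      · exact absurd h (by positivity)
    have hs : s = 1 := by linarith
    simp [hs, ht]
  · intro i z hz hz'
    simp only [closedFan] at hz hz'
    rw [← polar_zero (sectorStart δ i + sectorWidth δ)] at hz
    obtain ⟨x, -, -, hx⟩ := mem_segment_polar zero_le_one hz
    obtain ⟨y, hy, -, hy'⟩ := mem_segment_polar (a := r) (b := r - l₂) (by linarith)
      (by rwa [segment_symm] at hz')
    have h := hc i y 1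
    have hyp : 0 < y := by linarith
    rw [← hy', hx, cross_polar, sub_self, Real.sin_zero, mul_zero] at h
    exact absurd h.symm (by positivity)

theorem openFan_isFan {l₁ l₂ δ : ℝ} (h₁ : 0 < l₁) (h₂ : 0 < l₂) (hl₁ : l₁ < 1) (hl₂ : l₂ < 1)
    (hw : 0 < sectorWidth δ) : IsFan l₁ l₂ δ (openFan l₁ l₂ δ) := by
  have hmem : ∀ i ρ, 0 < ρ →
      polar ρ (openDirection δ i) ∈ sector (sectorStart δ i) (sectorWidth δ) := by
    intro i ρ hρ
    rw [openDirection]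
    split_ifs
    · exact (sectorStart_add_mem hρ hw i).1
    · exact (sectorStart_add_mem hρ hw i).2
  refine ⟨rfl, ?_, ?_, ?_, ?_, ?_, ?_, ?_, ?_, ?_, ?_⟩
  · intro i
    simp only [openFan, dist_zero_right]
    exact norm_polar zero_le_one _
  · intro i
    simp only [openFan]
    rw [dist_polar, add_sub_cancel_left, abs_of_pos h₁]
  · intro i
    simp only [openFan]
    rw [dist_polar, add_sub_cancel_left, abs_of_pos h₂]
  · exact fun i => hmem i _ one_pos
  · exact fun i => hmem i _ (by linarith)
  · exact fun i => hmem i _ (by linarith)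
  · rintro (_ | i | i | i) <;> simp only [openFan]
    · simp
    · rw [norm_polar zero_le_one]; norm_num
    · rw [norm_polar (by linarith)]; linarith
    · rw [norm_polar (by linarith)]; linarith
  all_goals intro i z hz hz'; simp only [openFan] at hz hz' ⊢
  · rw [← polar_zero (openDirection δ i)] at hz
    obtain ⟨x, a, b, hx⟩ := mem_segment_polar zero_le_one hz
    obtain ⟨y, c, d, hy⟩ := mem_segment_polar (by linarith) hz'
    have := polar_left_injective a (by linarith) (hx.symm.trans hy)
    rw [hx, show x = 1 by linarith]
  · obtain ⟨x, a, b, hx⟩ := mem_segment_polar (by linarith) hz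
    obtain ⟨y, c, d, hy⟩ := mem_segment_polar (by linarith) hz'
    have := polar_left_injective (by linarith) (by linarith) (hx.symm.trans hy)
    rw [hx, show x = 1 + l₁ by linarith]
  · rw [← polar_zero (openDirection δ i)] at hz
    obtain ⟨x, a, b, hx⟩ := mem_segment_polar zero_le_one hz
    obtain ⟨y, c, d, hy⟩ := mem_segment_polar (by linarith) hz'
    have := polar_left_injective a (by linarith) (hx.symm.trans hy)
    linarith

/-- Parameters for closed and open fans. -/
theorem Lockable.exists_fan {l₁ l₂ : ℝ} (h : Lockable 8 l₁ l₂) :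
    ∃ δ r : ℝ, 0 < δ ∧ 0 < sectorWidth δ ∧ 2 * δ < angleAlpha 8 l₁ ∧ l₂ < r ∧
      r ^ 2 < 1 - l₁ ^ 2 ∧ r ^ 2 - 2 * r * Real.cos (sectorWidth δ) + 1 = l₁ ^ 2 := by
  have hpi := Real.pi_pos
  have hα : 0 < angleAlpha 8 l₁ := angleAlpha_pos (by norm_num) h.l₁_lt_one
  have he : 2 * Real.pi / (8 : ℕ) = Real.pi / 4 := by push_cast; ring
  have hl := h.l₂_lt
  have hβ := h.mean_lt_beta
  rw [he] at hl hβ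
  have hcont : Continuous (distP l₁) := by unfold distP; fun_prop
  -- The assumption l₂ < l_P(π/4) is open in the angle, so it survives for a sector slightly
  -- narrower than π/4. The lower bound on φ makes the gap smaller than α.
  have e1 : ∀ᶠ φ in nhdsWithin (Real.pi / 4) (Set.Iio (Real.pi / 4)), l₂ < distP l₁ φ :=
    (hcont.tendsto (Real.pi / 4)).mono_left nhdsWithin_le_nhds |>.eventually_const_lt hl
  have e2 : ∀ᶠ φ in nhdsWithin (Real.pi / 4) (Set.Iio (Real.pi / 4)),
      max 0 (Real.pi / 4 - angleAlpha 8 l₁) < φ :=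
    Filter.Eventually.filter_mono nhdsWithin_le_nhds
      (eventually_gt_nhds (max_lt (by linarith) (by linarith)))
  obtain ⟨φ, ⟨h1, h2⟩, h3⟩ := ((e1.and e2).and self_mem_nhdsWithin).exists
  have h3 : φ < Real.pi / 4 := h3
  obtain ⟨h4, h5⟩ := max_lt_iff.1 h2
  have hsw : sectorWidth ((Real.pi / 4 - φ) / 2) = φ := by rw [sectorWidth]; ring
  have hsin : Real.sin φ < l₁ := by
    rw [← sin_angleBeta h.l₁_pos h.l₁_lt_one]
    exact Real.sin_lt_sin_of_lt_of_le_pi_div_two (by linarith)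
      (angleBeta_lt h.l₁_lt_one).le (by linarith)
  have hsin0 : 0 < Real.sin φ := Real.sin_pos_of_pos_of_lt_pi h4 (by linarith)
  have hpos : 0 < l₁ ^ 2 - Real.sin φ ^ 2 := by nlinarith
  have hw := Real.sqrt_pos.2 hpos
  have hw2 := Real.sq_sqrt hpos.le
  have hsc := Real.sin_sq_add_cos_sq φ
  have hr0 : 0 < distP l₁ φ := h.l₂_pos.trans h1
  -- r is the smaller root of the quadratic for AB = l₁. The product of the roots is 1 − l₁², which
  -- gives r² < 1 − l₁².
  refine ⟨(Real.pi / 4 - φ) / 2, distP l₁ φ, by linarith, by rwa [hsw], by linarith, h1, ?_, ?_⟩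
  · rw [distP] at hr0 ⊢
    nlinarith
  · rw [hsw, distP]
    linear_combination hw2 - hsc

theorem sectorStart_sub_one (δ : ℝ) (i : Fin 8) :
    ∃ m : ℤ, sectorStart δ (i - 1) = sectorStart δ i - Real.pi / 4 + m * (2 * Real.pi) := by
  obtain ⟨m, hm⟩ : ∃ m : ℤ, ((i - 1).val : ℤ) = i.val - 1 + 8 * m := by
    -- Only petal 0 wraps around, to petal 7 and thus by a full turn.
    refine ⟨if i = 0 then 1 else 0, ?_⟩
    revert i; decide
  refine ⟨m, ?_⟩
  have : ((i - 1).val : ℝ) = i.val - 1 + 8 * m := by exact_mod_cast hm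
  rw [sectorStart, sectorStart, this]; ring

/-- Measured from OA', the joints B and C are in direction 2δ and A is in direction π/4 < β. Since C
is on OB, nearer to the centre than B, its projections are shorter. -/
theorem closedFan_nested {l₁ l₂ δ r : ℝ} (h : Lockable 8 l₁ l₂) (h0 : 0 < δ)
    (hw : 0 < sectorWidth δ) (hr : l₂ < r) (hr2 : r ^ 2 < 1 - l₁ ^ 2) (i : Fin 8) :
    NestedPetal l₁ (closedFan l₂ δ r (.A (i - 1))) (closedFan l₂ δ r (.A i))
      (closedFan l₂ δ r (.B i)) (closedFan l₂ δ r (.C i)) := by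
  have hpi := Real.pi_pos
  have hl2 := h.l₂_pos
  have hr0 : 0 < r := hl2.trans hr
  have hβ := h.mean_lt_beta
  have he : 2 * Real.pi / (8 : ℕ) = Real.pi / 4 := by push_cast; ring
  rw [he] at hβ
  have hβ' := angleBeta_lt h.l₁_lt_one
  obtain ⟨m, hm⟩ := sectorStart_sub_one δ i
  have hA : closedFan l₂ δ r (.A (i - 1)) = polar 1 (sectorStart δ i - 2 * δ) := by
    rw [closedFan, hm, sectorWidth, ← polar_add_two_pi 1 (sectorStart δ i - 2 * δ) m]
    congr 1; ring
  rw [hA]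
  simp only [closedFan]
  have hw' : sectorWidth δ + 2 * δ = Real.pi / 4 := by rw [sectorWidth]; ring
  have e1 : sectorStart δ i + sectorWidth δ - (sectorStart δ i - 2 * δ) = Real.pi / 4 := by
    rw [← hw']; ring
  have e2 : sectorStart δ i - (sectorStart δ i - 2 * δ) = 2 * δ := by ring
  have s1 : 0 < Real.sin (Real.pi / 4) := Real.sin_pos_of_pos_of_lt_pi (by linarith) (by linarith)
  have s2 : 0 < Real.sin (2 * δ) := Real.sin_pos_of_pos_of_lt_pi (by linarith) (by linarith)
  have s3 : 0 < Real.sin (sectorWidth δ) := Real.sin_pos_of_pos_of_lt_pi hw (by linarith)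
  have c2 : 0 < Real.cos (2 * δ) := Real.cos_pos_of_mem_Ioo ⟨by linarith, by linarith⟩
  have c3 : 0 < Real.cos (sectorWidth δ) := Real.cos_pos_of_mem_Ioo ⟨by linarith, by linarith⟩
  have hrl : 0 < r - l₂ := by linarith
  constructor <;> simp only [dot_polar, cross_polar, e1, e2, add_sub_cancel_left, sub_self,
    Real.cos_zero, one_mul, mul_one]
  · exact s1
  · exact Real.cos_lt_cos_of_nonneg_of_le_pi (by linarith) (by linarith) hβ
  · positivity
  · positivity
  · linarith
  · positivity
  · positivity
  · gcongr; linarith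
  · rw [sub_add_cancel_left, Real.cos_neg]
    gcongr; linarith

/-- Petal 1 is the witness: its angle is 2δ, which was chosen below α. -/
theorem openFan_isOpenTree {l₁ l₂ δ : ℝ} (h0 : 0 < δ) (hw : 0 < sectorWidth δ)
    (hα : 2 * δ < angleAlpha 8 l₁) (o : ℂ) : IsOpenTree l₁ fun x => o + openFan l₁ l₂ δ x := by
  have hpi := Real.pi_pos
  refine ⟨1, ?_⟩
  have hw' : sectorWidth δ = Real.pi / 4 - 2 * δ := rfl
  have : petalAngle (fun x => o + openFan l₁ l₂ δ x) 1 = 2 * δ := by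
    have e0 : openFan l₁ l₂ δ (.A (1 - 1)) = polar 1 (Real.pi / 4 - δ) := by
      have : (1 - 1 : Fin 8) = 0 := rfl
      rw [this, openFan, openDirection, if_neg (by decide), sectorStart, hw']
      congr 1
      simp; ring
    have e1 : openFan l₁ l₂ δ (.A 1) = polar 1 (Real.pi / 4 + δ) := by
      rw [openFan, openDirection, if_pos rfl, sectorStart]
      congr 1
      simp
    refine ccwAngle_polar (O := o + openFan l₁ l₂ δ .O) (ρ := 1) (σ := 1)
      (x := Real.pi / 4 - δ) (y := Real.pi / 4 + δ) one_pos one_pos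
      ⟨by linarith, by linarith⟩ ⟨by linarith, by linarith⟩ ?_ ?_ |>.trans ?_
    · exact (add_sub_add_left_eq_sub _ _ o).trans (by rw [e0]; simp [openFan])
    · exact (add_sub_add_left_eq_sub _ _ o).trans (by rw [e1]; simp [openFan])
    · rw [if_pos (by linarith)]; ring
  rwa [this]

/-- The fans of a row with given labels. -/
def labelledFan (l₁ l₂ δ r : ℝ) (b : Bool) : Joint 8 → ℂ :=
  if b then openFan l₁ l₂ δ else closedFan l₂ δ r

/-- Simple configurations of the chain, one for each label. -/
theorem Lockable.exists_configurations {l₁ l₂ L : ℝ} (h : Lockable 8 l₁ l₂) (hL : 0 < L)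
    (hL6 : 6 ≤ L) (k : ℕ) :
    ∃ p : (Fin k → Bool) → (chain k 8 l₁ l₂ L h.l₁_pos h.l₂_pos hL).Configuration,
      (∀ s, IsStretched L (p s).1 ∧
        ∀ j, (s j = false → IsClosedTree l₁ (copy (p s).1 j)) ∧
          (s j = true → IsOpenTree l₁ (copy (p s).1 j))) ∧
      (∀ s s', (chain k 8 l₁ l₂ L h.l₁_pos h.l₂_pos hL).SameRotation (p s).1 (p s').1) := by
  obtain ⟨δ, r, h0, hw, hα, hr, hr2, hd⟩ := h.exists_fan
  have hr1 : r < 1 := by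
    have := h.l₁_pos
    have := h.l₂_pos
    nlinarith
  have hfan : ∀ b, IsFan l₁ l₂ δ (labelledFan l₁ l₂ δ r b) := by
    intro b
    cases b
    · exact closedFan_isFan h.l₁_pos h.l₂_pos h0 hw hr hr1 hd
    · exact openFan_isFan h.l₁_pos h.l₂_pos h.l₁_lt_one h.l₂_lt_one hw
  have hs : ∀ s : Fin k → Bool, (chain k 8 l₁ l₂ L h.l₁_pos h.l₂_pos hL).IsSimple
      (fanRow L fun j => labelledFan l₁ l₂ δ r (s j)) :=
    fun s => fanRow_isSimple h0 hw hL6 fun j => hfan _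
  refine ⟨fun s => ⟨_, hs s⟩, fun s => ⟨⟨0, 1, norm_one, fun j => ?_⟩, fun j => ⟨fun hj => ?_,
    fun hj => ?_⟩⟩, fun s s' => fanRow_sameRotation h0 (fun j => hfan _) (fun j => hfan _)
      (hs s) (hs s')⟩
  · simp [fanRow, (hfan (s j)).zero]
  · have hsimple : (petalTree 8 l₁ l₂ h.l₁_pos h.l₂_pos).IsSimple
        (copy (fanRow L fun j => labelledFan l₁ l₂ δ r (s j)) j) :=
      (hs s).comp (f := fun x => (j, x)) (Prod.mk_right_injective j) (chain_adj_copy j)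
        (chain_len_copy j)
    refine (isClosedTree_iff h hsimple).2 fun i => ?_
    have e : ∀ x, copy (fanRow L fun j => labelledFan l₁ l₂ δ r (s j)) j x -
        copy (fanRow L fun j => labelledFan l₁ l₂ δ r (s j)) j .O = closedFan l₂ δ r x := by
      intro x
      simp [copy, fanRow, hj, labelledFan, closedFan]
    unfold IsNested
    rw [e, e, e, e]
    exact closedFan_nested h h0 hw hr hr2 i
  · have e : copy (fanRow L fun j => labelledFan l₁ l₂ δ r (s j)) j =
        fun x => ((j.val * L : ℝ) : ℂ) + openFan l₁ l₂ δ x := by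
      funext x
      simp [copy, fanRow, hj, labelledFan]
    change IsOpenTree l₁ (copy (fanRow L fun j => labelledFan l₁ l₂ δ r (s j)) j)
    rw [e]
    exact openFan_isOpenTree h0 hw hα _

/-! ### Admissible lengths, and trees with a prescribed number of links -/

/-- There are admissible lengths for eight petals. -/
theorem exists_lockable : ∃ l₁ l₂ : ℝ, Lockable 8 l₁ l₂ := by
  have hpi := Real.pi_pos
  -- With l₁² = 51/100 the root in l_P(π/4) is √(51/100 − 1/2) = 1/10.
  set l₁ := Real.sqrt (51 / 100) with hl
  have hl2 : l₁ ^ 2 = 51 / 100 := Real.sq_sqrt (by norm_num)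
  have hl0 : 0 < l₁ := Real.sqrt_pos.2 (by norm_num)
  have hl1 : l₁ < 1 := by nlinarith
  have hl7 : 7 / 10 < l₁ := by nlinarith
  have h2 : Real.sqrt 2 ^ 2 = 2 := Real.sq_sqrt (by norm_num)
  have h20 : 0 < Real.sqrt 2 := Real.sqrt_pos.2 (by norm_num)
  have h2l : 7 / 5 < Real.sqrt 2 := by nlinarith
  have h2u : Real.sqrt 2 < 71 / 50 := by nlinarith
  have he : 2 * Real.pi / (8 : ℕ) = Real.pi / 4 := by push_cast; ring
  set D := Real.sqrt 2 / 2 - 1 / 10 with hD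
  have hdist : distP l₁ (Real.pi / 4) = D := by
    have : l₁ ^ 2 - (Real.sqrt 2 / 2) ^ 2 = (1 / 10) ^ 2 := by
      rw [hl2, div_pow, h2]; norm_num
    rw [distP, Real.cos_pi_div_four, Real.sin_pi_div_four, this, Real.sqrt_sq (by norm_num)]
  have hβ : Real.pi / 4 < angleBeta l₁ := by
    rw [angleBeta, Real.lt_arcsin_iff_sin_lt ⟨by linarith, by linarith⟩ ⟨by linarith, hl1.le⟩,
      Real.sin_pi_div_four]
    nlinarith
  have hα : angleAlpha 8 l₁ < Real.pi / 4 := by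
    rw [angleAlpha, div_lt_iff₀ (by norm_num)]
    push_cast; linarith
  -- For l₂ = l_P(π/4) the triangle defining θₘ is OAP, so θₘ = π/4. Since β > π/4 gives α < π/4,
  -- every l₂ just below D has α < θₘ by continuity. The remaining lower bound holds as sin β cos β
  -- ≤ 1/2 < l₂.
  have hDm : angleMin l₁ D = Real.pi / 4 := by
    have : (1 - l₁ ^ 2 + D ^ 2) / (2 * D) = Real.cos (Real.pi / 4) := by
      rw [Real.cos_pi_div_four, hl2, hD, div_eq_iff (by linarith)]
      linear_combination (-1 / 4 : ℝ) * h2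
    rw [angleMin, this, Real.arccos_cos (by linarith) (by linarith)]
  have hcont : ContinuousAt (angleMin l₁) D := by
    unfold angleMin
    refine Real.continuous_arccos.continuousAt.comp ?_
    exact ContinuousAt.div (by fun_prop) (by fun_prop) (by linarith)
  have e1 : ∀ᶠ x in nhdsWithin D (Set.Iio D), angleAlpha 8 l₁ < angleMin l₁ x :=
    (hcont.tendsto.mono_left nhdsWithin_le_nhds).eventually_const_lt (by rwa [hDm])
  have e2 : ∀ᶠ x in nhdsWithin D (Set.Iio D), 1 / 2 < x :=
    Filter.Eventually.filter_mono nhdsWithin_le_nhds (eventually_gt_nhds (by linarith))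
  obtain ⟨l₂, ⟨h3, h4⟩, h5⟩ := ((e1.and e2).and self_mem_nhdsWithin).exists
  have h5 : l₂ < D := h5
  refine ⟨l₁, l₂, by norm_num, hl0, by linarith, hl1, by rwa [he], by rwa [he, hdist], ?_,
    by linarith, h3⟩
  have hs := sin_angleBeta hl0 hl1
  have hsc := Real.sin_sq_add_cos_sq (angleBeta l₁)
  nlinarith [sq_nonneg (Real.sin (angleBeta l₁) - Real.cos (angleBeta l₁))]

/-- Trees with `N` links and exponentially many classes of configurations. -/
theorem exists_tree_many_classes {l₁ l₂ : ℝ} (h : Lockable 8 l₁ l₂) {N : ℕ} (hN : 50 ≤ N) :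
    ∃ (V : Type) (_ : Fintype V) (T : Linkage V), T.graph.IsTree ∧ T.numLinks = N ∧
      ∃ m : ℕ, (2 : ℝ) ^ ((1 / 50 : ℝ) * (N : ℝ)) ≤ (m : ℝ) ∧ (m : ℕ∞) ≤ ENat.card T.Classes := by
  -- Each petal tree with its long link uses 25 links, so k copies fit into N links; k ≥ N/50 since
  -- k ≥ 1.
  set k := N / 25 with hk
  have hk1 : 25 * k ≤ N := Nat.mul_div_le N 25
  have hk2 : N < 25 * k + 25 := by omega
  -- The row of m centres has N − 24k long links and the petals have 24k, which makes N in total.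
  set m := N - 24 * k + 1 with hm
  have hkm : k ≤ m := by omega
  have hL : (0 : ℝ) < 6 := by norm_num
  let T := (chain m 8 l₁ l₂ 6 h.l₁_pos h.l₂_pos hL).comap (partialInclusion hkm)
  obtain ⟨t1, t2⟩ := partialChain_isTree hkm (by omega)
  refine ⟨PartialChain m k, inferInstance, T, t1, ?_, 2 ^ k, ?_, ?_⟩
  · change ((chainGraph m 8).comap (partialInclusion hkm)).edgeSet.ncard = N
    omega
  · push_cast
    rw [← Real.rpow_natCast]
    apply Real.rpow_le_rpow_of_exponent_le (by norm_num)
    have h1 : (N : ℝ) ≤ 50 * k := by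
      have : N ≤ 50 * k := by omega
      exact_mod_cast this
    linarith
  · obtain ⟨p, hp, -⟩ := h.exists_configurations hL le_rfl m
    -- The default label of the later copies is immaterial, since their petals are dropped.
    let extend : (Fin k → Bool) → Fin m → Bool := fun s j =>
      if hj : j.val < k then s ⟨j, hj⟩ else false
    let p' : (Fin k → Bool) → T.Configuration := fun s =>
      ⟨(p (extend s)).1 ∘ partialInclusion hkm,
        (p (extend s)).2.comap (partialInclusion_injective hkm)⟩
    have hcopy : ∀ s j, (p' s).1 ∘ partialCopy hkm j = copy (p (extend s)).1 (j.castLE hkm) := by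
      intro s j
      funext x
      exact congrArg (p (extend s)).1 (partialInclusion_partialCopy hkm j x)
    have hext : ∀ s j, extend s (Fin.castLE hkm j) = s j := fun s j => by simp [extend]
    apply le_card_classes (p := p')
    apply not_equivalent_of_labels h (e := partialCopy hkm)
    · intro j x y hxy
      have := congrArg (partialInclusion hkm) hxy
      rw [partialInclusion_partialCopy, partialInclusion_partialCopy] at this
      exact congrArg Prod.snd this
    · intro j x y hxy
      change (chainGraph m 8).Adj _ _
      rw [partialInclusion_partialCopy, partialInclusion_partialCopy]
      exact chain_adj_copy _ _ _ hxy
    · intro j x y hxy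
      change chainLen l₁ l₂ 6 _ _ = _
      rw [partialInclusion_partialCopy, partialInclusion_partialCopy]
      exact chain_len_copy _ _ _ hxy
    · intro s j
      rw [hcopy, ← hext s j]
      exact (hp (extend s)).2 _

end TreeLinkage

end

open TreeLinkage in
theorem corollary6 :
    -- `N`-link tree linkages with `2 ^ Ω(N)` equivalence classes of simple configurations
    (∃ c : ℝ, 0 < c ∧ ∃ N₀ : ℕ, ∀ N : ℕ, N₀ ≤ N →
      ∃ (V : Type) (_ : Fintype V) (T : Linkage V),
        T.graph.IsTree ∧ T.numLinks = N ∧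
          ∃ m : ℕ, (2 : ℝ) ^ (c * (N : ℝ)) ≤ (m : ℝ) ∧ (m : ℕ∞) ≤ ENat.card T.Classes) ∧
    -- there are eight-petal trees that satisfy the constraints
    (∃ l₁ l₂ : ℝ, Lockable 8 l₁ l₂) ∧
    -- `k` copies of any such tree, joined by long links
    (∀ (l₁ l₂ : ℝ) (h : Lockable 8 l₁ l₂), ∃ L₀ : ℝ, ∀ (L : ℝ) (hL : 0 < L), L₀ ≤ L →
      ∀ k : ℕ, 1 ≤ k →
        let T := chain k 8 l₁ l₂ L h.l₁_pos h.l₂_pos hL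
        T.graph.IsTree ∧ T.numLinks = 24 * k + (k - 1) ∧
        -- each copy can be closed or open, independently of the others
        (∃ p : (Fin k → Bool) → T.Configuration,
          (∀ s, IsStretched L (p s).1 ∧
            ∀ j, (s j = false → IsClosedTree l₁ (copy (p s).1 j)) ∧
              (s j = true → IsOpenTree l₁ (copy (p s).1 j))) ∧
          (∀ s s', T.SameRotation (p s).1 (p s').1) ∧
          (∀ s s', s ≠ s' → ¬ T.Equivalent (p s) (p s'))) ∧
        -- a closed copy stays closed, and is never open, during any motion
        (∀ (p q : T.Configuration) (γ : T.Motion p q) (j : Fin k),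
          IsClosedTree l₁ (copy p.1 j) →
            ∀ t, IsClosedTree l₁ (copy (γ t).1 j) ∧ ¬ IsOpenTree l₁ (copy (γ t).1 j)) ∧
        ((2 ^ k : ℕ) : ℕ∞) ≤ ENat.card T.Classes) := by
  obtain ⟨l₁, l₂, h⟩ := exists_lockable
  refine ⟨⟨1 / 50, by norm_num, 50, fun N hN => exists_tree_many_classes h hN⟩, ⟨l₁, l₂, h⟩, ?_⟩
  intro l₁ l₂ h
  -- Every fan lies within distance 3 of its centre, because 1 + l₁ + l₂ < 3; hence L₀ = 6.
  refine ⟨6, fun L hL hL6 k hk => ?_⟩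
  intro T
  obtain ⟨p, hp, hrot⟩ := h.exists_configurations hL hL6 k
  have hne : ∀ s s', s ≠ s' → ¬ T.Equivalent (p s) (p s') :=
    not_equivalent_of_labels (T := T) h (e := fun j x => (j, x)) (fun j => Prod.mk_right_injective j)
      chain_adj_copy chain_len_copy fun s j => (hp s).2 j
  refine ⟨(chain_isTree hk).1, (chain_isTree hk).2, ⟨p, hp, hrot, hne⟩, ?_, le_card_classes hne⟩
  intro p q γ j h0 t
  have := isClosedTree_of_motion (T := T) h (e := fun x => (j, x)) (Prod.mk_right_injective j)
    (chain_adj_copy j) (chain_len_copy j) γ h0 t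
  exact ⟨this, this.not_isOpenTree⟩
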